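/- Let $(M^5,g,\xi,\eta,\varphi)$ be an almost contact metric $5$-manifold, i.e. a smooth Riemannian $5$-manifold $(M,g)$ with a smooth unit vector field $\xi$, its dual $1$-form $\eta$ and a smooth endomorphism field $\varphi$ of $TM$ such that $\varphi(\xi)=0$, $\varphi^2=-\mathrm{Id}+\eta\otimes\xi$ and $g(\varphi X,\varphi Y)=g(X,Y)-\eta(X)\eta(Y)$. Let $\nabla^g$ be the Levi-Civita connection and put $$\Phi(X,Y)=g(X,\varphi Y),\qquad [\varphi,\varphi](X,Y)=[\varphi X,\varphi Y]+\varphi^2[X,Y]-\varphi[\varphi X,Y]-\varphi[X,\varphi Y],$$ $$N(X,Y,Z)=g(X,[\varphi,\varphi](Y,Z))+\eta(X)\,d\eta(Y,Z),\qquad \gamma(X,Y)=d\Phi(\xi,\varphi X,Y),$$ where $d\eta(X,Y)=(\nabla^g_X\eta)(Y)-(\nabla^g_Y\eta)(X)$ and $d\Phi(X,Y,Z)=(\nabla^g_X\Phi)(Y,Z)-(\nabla^g_Y\Phi)(X,Z)+(\nabla^g_Z\Phi)(X,Y)$. An adapted frame is a local orthonormal frame $(e_1,\dots,e_5)$ with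 $\Phi=e_1\wedge e_2+e_3\wedge e_4$ and $\eta=e_5$. The manifold is called generalized quasi-Sasaki if $N(X,Y,Z)=0$ and $d\Phi(X,Y,Z)=0$ for all $X,Y,Z$ orthogonal to $\xi$, and $\xi$ is a Killing vector field. The intrinsic torsion is $\Gamma(X)=\mathrm{pr}_{\mathfrak u(2)^\perp}\big(g(\nabla^g_Xe_i,e_j)\big)_{i,j}$ for an adapted frame $(e_i)$, where $\mathfrak u(2)\subset\mathfrak{so}(5)$ is the algebra of skew-symmetric matrices commuting with $\varphi$ and $\mathfrak{so}(5)$ carries the inner product $-\tfrac12\mathrm{tr}(xy)$; using $\mathfrak{so}(5)\cong\Lambda^2$ it is regarded as a tensor $\Gamma(X,Y,Z)=\Gamma(X)(Y,Z)$. Let $\Lambda^2_2=\{\beta\in\Lambda^2\mid \Phi\wedge\beta=0,\ {*\beta}=\eta\wedge\beta\}$, where $*$ is the Hodge operator for the orientation given by adapted frames. Let $\mathcal W_4$ be the space of the tensors $*\beta$, $\beta\in\Lambda^2_2$, and $\mathcal W_7$ the space of the tensors $(X,Y,Z)\mapsto 3\,\eta(X)\beta(Y,Z)-{*\beta}(X,Y,Z)$,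 $\beta\in\Lambda^2_2$. The manifold is of class $\mathcal W$ if $\Gamma\in\mathcal W$ at every point. **Theorem.** $(M^5,g,\xi,\eta,\varphi)$ is of class $\mathcal W_4\oplus\mathcal W_7$ if and only if it is a generalized quasi-Sasaki manifold such that $N(\xi,X,Y)=2\,d\eta(X,Y)$ for all $X,Y$. Moreover, any almost contact metric $5$-manifold of class $\mathcal W_4\oplus\mathcal W_7$ is of class a) $\mathcal W_4$ if and only if $N$ is totally skew-symmetric (i.e. $N(X,Y,Z)+N(Y,X,Z)=0$), or equivalently if $\gamma=-2\,d\eta$. In this case, $N(X,Y,Z)=2\,(d\eta\wedge\eta)(X,Y,Z)$, where $(d\eta\wedge\eta)(X,Y,Z)=d\eta(X,Y)\eta(Z)+d\eta(Y,Z)\eta(X)+d\eta(Z,X)\eta(Y)$. b) $\mathcal W_7$ if and only if $N$ is traceless cyclic (i.e. $N(X,Y,Z)+N(Y,Z,X)+N(Z,X,Y)=0$ and $\sum_iN(e_i,e_i,X)=0$ for orthonormal $(e_i)$), or equivalently if $\gamma=d\eta$. In this case, $N(X,Y,Z)=2\,\eta(X)d\eta(Y,Z)+\eta(Y)d\eta(X,Z)-\eta(Z)d\eta(X,Y)$.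 -/

import Mathlib

open Bundle VectorField FiberBundle
open scoped Manifold ContDiff Topology

set_option linter.unusedSectionVars false

noncomputable section

namespace ACM

section LeviCivita

variable {E : Type*} [NormedAddCommGroup E] [NormedSpace ℝ E]
  {H : Type*} [TopologicalSpace H] {I : ModelWithCorners ℝ E H}
  {M : Type*} [TopologicalSpace M] [ChartedSpace H M] [IsManifold I ∞ M]

/-- A smooth Riemannian metric on a manifold. -/
abbrev Metric (I : ModelWithCorners ℝ E H) (M : Type*) [TopologicalSpace M] [ChartedSpace H M]
    [IsManifold I ∞ M] :=
  ContMDiffRiemannianMetric I ∞ E (fun x : M ↦ TangentSpace I x)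

theorem Metric.mdiffAt (g : Metric I M) {X Y : Π x : M, TangentSpace I x} {x : M}
    (hX : MDiffAt (T% X) x) (hY : MDiffAt (T% Y) x) :
    MDiffAt (fun y ↦ g.inner y (X y) (Y y)) x := by
  have : MDifferentiableAt I (I.prod 𝓘(ℝ))
      (fun m ↦ TotalSpace.mk' ℝ (E := Bundle.Trivial M ℝ) m (g.inner m (X m) (Y m))) x := by
    apply MDifferentiableAt.clm_bundle_apply₂ (F₁ := E) (F₂ := E)
    · exact g.contMDiff.mdifferentiableAt (by simp)
    · exact hX
    · exact hY
  simp only [mdifferentiableAt_totalSpace] at this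
  exact this.2

/-- The Koszul expression, which equals `2 g(∇_X Y, Z)`. -/
def koszul (g : Metric I M) (Y X Z : Π x : M, TangentSpace I x) (x : M) : ℝ :=
  d% (fun y ↦ g.inner y (Y y) (Z y)) x (X x) + d% (fun y ↦ g.inner y (X y) (Z y)) x (Y x)
    - d% (fun y ↦ g.inner y (X y) (Y y)) x (Z x)
    + g.inner x (mlieBracket I X Y x) (Z x) - g.inner x (mlieBracket I X Z x) (Y x)
    - g.inner x (mlieBracket I Y Z x) (X x)

variable [FiniteDimensional ℝ E]

theorem tensorial_koszul_left (g : Metric I M) {Y Z : Π x : M, TangentSpace I x} {x : M}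
    (hY : MDiffAt (T% Y) x) (hZ : MDiffAt (T% Z) x) :
    TensorialAt I E (koszul g Y · Z x) x where
  smul {f X} hf hX := by
    have e1 : (fun y ↦ g.inner y ((f • X) y) (Z y)) = f * fun y ↦ g.inner y (X y) (Z y) := by
      ext y; simp
    have e2 : (fun y ↦ g.inner y ((f • X) y) (Y y)) = f * fun y ↦ g.inner y (X y) (Y y) := by
      ext y; simp
    simp only [koszul, e1, e2]
    rw [mvfderiv_mul hf (g.mdiffAt hX hZ), mvfderiv_mul hf (g.mdiffAt hX hY),
      mlieBracket_smul_left hf hX, mlieBracket_smul_left hf hX]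
    simp
    ring
  add {X X'} hX hX' := by
    have e1 : (fun y ↦ g.inner y ((X + X') y) (Z y)) =
      (fun y ↦ g.inner y (X y) (Z y)) + fun y ↦ g.inner y (X' y) (Z y) := by
      ext y; simp
    have e2 : (fun y ↦ g.inner y ((X + X') y) (Y y)) =
      (fun y ↦ g.inner y (X y) (Y y)) + fun y ↦ g.inner y (X' y) (Y y) := by
      ext y; simp
    simp only [koszul, e1, e2]
    rw [mvfderiv_add (g.mdiffAt hX hZ) (g.mdiffAt hX' hZ),
      mvfderiv_add (g.mdiffAt hX hY) (g.mdiffAt hX' hY),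
      mlieBracket_add_left hX hX', mlieBracket_add_left hX hX']
    simp
    ring

theorem tensorial_koszul_right (g : Metric I M) {Y X : Π x : M, TangentSpace I x} {x : M}
    (hY : MDiffAt (T% Y) x) (hX : MDiffAt (T% X) x) :
    TensorialAt I E (koszul g Y X · x) x where
  smul {f Z} hf hZ := by
    have e1 : (fun y ↦ g.inner y (Y y) ((f • Z) y)) = f * fun y ↦ g.inner y (Y y) (Z y) := by
      ext y; simp
    have e2 : (fun y ↦ g.inner y (X y) ((f • Z) y)) = f * fun y ↦ g.inner y (X y) (Z y) := by
      ext y; simp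
    simp only [koszul, e1, e2]
    rw [mvfderiv_mul hf (g.mdiffAt hY hZ), mvfderiv_mul hf (g.mdiffAt hX hZ),
      mlieBracket_smul_right hf hZ, mlieBracket_smul_right hf hZ]
    simp [g.symm x (Z x)]
    ring
  add {Z Z'} hZ hZ' := by
    have e1 : (fun y ↦ g.inner y (Y y) ((Z + Z') y)) =
      (fun y ↦ g.inner y (Y y) (Z y)) + fun y ↦ g.inner y (Y y) (Z' y) := by
      ext y; simp
    have e2 : (fun y ↦ g.inner y (X y) ((Z + Z') y)) =
      (fun y ↦ g.inner y (X y) (Z y)) + fun y ↦ g.inner y (X y) (Z' y) := by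
      ext y; simp
    simp only [koszul, e1, e2]
    rw [mvfderiv_add (g.mdiffAt hY hZ) (g.mdiffAt hY hZ'),
      mvfderiv_add (g.mdiffAt hX hZ) (g.mdiffAt hX hZ'),
      mlieBracket_add_right hZ hZ', mlieBracket_add_right hZ hZ']
    simp
    ring

theorem koszul_add (g : Metric I M) {Y Y' X Z : Π x : M, TangentSpace I x} {x : M}
    (hY : MDiffAt (T% Y) x) (hY' : MDiffAt (T% Y') x) (hX : MDiffAt (T% X) x)
    (hZ : MDiffAt (T% Z) x) :
    koszul g (Y + Y') X Z x = koszul g Y X Z x + koszul g Y' X Z x := by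
  have e1 : (fun y ↦ g.inner y ((Y + Y') y) (Z y)) =
      (fun y ↦ g.inner y (Y y) (Z y)) + fun y ↦ g.inner y (Y' y) (Z y) := by
    ext y; simp
  have e2 : (fun y ↦ g.inner y (X y) ((Y + Y') y)) =
      (fun y ↦ g.inner y (X y) (Y y)) + fun y ↦ g.inner y (X y) (Y' y) := by
    ext y; simp
  simp only [koszul, e1, e2]
  rw [mvfderiv_add (g.mdiffAt hY hZ) (g.mdiffAt hY' hZ),
    mvfderiv_add (g.mdiffAt hX hY) (g.mdiffAt hX hY'),
    mlieBracket_add_left hY hY', mlieBracket_add_right hY hY']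
  simp
  ring

theorem koszul_smul (g : Metric I M) {Y X Z : Π x : M, TangentSpace I x} {f : M → ℝ} {x : M}
    (hY : MDiffAt (T% Y) x) (hf : MDiffAt f x) (hX : MDiffAt (T% X) x)
    (hZ : MDiffAt (T% Z) x) :
    koszul g (f • Y) X Z x
      = f x * koszul g Y X Z x + 2 * (d% f x (X x) * g.inner x (Y x) (Z x)) := by
  have e1 : (fun y ↦ g.inner y ((f • Y) y) (Z y)) = f * fun y ↦ g.inner y (Y y) (Z y) := by
    ext y; simp
  have e2 : (fun y ↦ g.inner y (X y) ((f • Y) y)) = f * fun y ↦ g.inner y (X y) (Y y) := by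
    ext y; simp
  simp only [koszul, e1, e2]
  rw [mvfderiv_mul hf (g.mdiffAt hY hZ), mvfderiv_mul hf (g.mdiffAt hX hY),
    mlieBracket_smul_left hf hY, mlieBracket_smul_right hf hY]
  simp [g.symm x (Y x)]
  ring

instance (x : M) : T2Space (TangentSpace I x) :=
  inferInstanceAs (T2Space E)

instance (x : M) : FiniteDimensional ℝ (TangentSpace I x) :=
  inferInstanceAs (FiniteDimensional ℝ E)

/-- The isomorphism between a tangent space and its dual given by the metric. -/
def flat (g : Metric I M) (x : M) : TangentSpace I x ≃ₗ[ℝ] (TangentSpace I x →L[ℝ] ℝ) :=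
  LinearEquiv.ofInjectiveOfFinrankEq (g.inner x).toLinearMap
    (by
      rw [← LinearMap.ker_eq_bot, LinearMap.ker_eq_bot']
      intro v hv
      by_contra h
      exact (g.pos x v h).ne' (by simpa using congr($hv v)))
    (by
      rw [← LinearEquiv.finrank_eq (LinearMap.toContinuousLinearMap (E := TangentSpace I x)
        (F' := ℝ) (𝕜 := ℝ))]
      exact Subspace.dual_finrank_eq.symm)

theorem inner_flat_symm (g : Metric I M) (x : M) (α : TangentSpace I x →L[ℝ] ℝ)
    (w : TangentSpace I x) : g.inner x ((flat g x).symm α) w = α w :=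
  congr($((flat g x).apply_symm_apply α) w)

open Classical in
/-- The Levi-Civita connection as a bare function, characterized by the Koszul formula
`2 g(∇_v Y, w) = koszul g Y V W x`. -/
def leviCivitaFun (g : Metric I M) (Y : Π x : M, TangentSpace I x) (x : M) :
    TangentSpace I x →L[ℝ] TangentSpace I x :=
  if hY : MDiffAt (T% Y) x then
    (LinearMap.toContinuousLinearMap (flat g x).symm.toLinearMap) ∘L
      ((1 / 2 : ℝ) • TensorialAt.mkHom₂ (F := E) (F' := E) (koszul g Y · · x) x
        (fun _ hZ ↦ tensorial_koszul_left g hY hZ) (fun _ hX ↦ tensorial_koszul_right g hY hX))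
  else 0

theorem inner_leviCivitaFun (g : Metric I M) {Y X Z : Π x : M, TangentSpace I x} {x : M}
    (hY : MDiffAt (T% Y) x) (hX : MDiffAt (T% X) x) (hZ : MDiffAt (T% Z) x) :
    2 * g.inner x (leviCivitaFun g Y x (X x)) (Z x) = koszul g Y X Z x := by
  rw [leviCivitaFun, dif_pos hY]
  have := TensorialAt.mkHom₂_apply (F := E) (F' := E) (Φ := (koszul g Y · · x))
        (fun _ hZ ↦ tensorial_koszul_left g hY hZ) (fun _ hX ↦ tensorial_koszul_right g hY hX) hX hZ
  simp [inner_flat_symm, this]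

theorem eq_of_inner_eq (g : Metric I M) {x : M} {v w : TangentSpace I x}
    (h : ∀ u, g.inner x v u = g.inner x w u) : v = w :=
  (flat g x).injective (ContinuousLinearMap.ext h)

theorem leviCivitaFun_unique (g : Metric I M) {Y : Π x : M, TangentSpace I x} {x : M}
    (hY : MDiffAt (T% Y) x) {L : TangentSpace I x →L[ℝ] TangentSpace I x}
    (h : ∀ {X Z : Π x : M, TangentSpace I x}, MDiffAt (T% X) x → MDiffAt (T% Z) x →
      2 * g.inner x (L (X x)) (Z x) = koszul g Y X Z x) : leviCivitaFun g Y x = L := by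
  ext1 v
  refine eq_of_inner_eq g fun w ↦ ?_
  have hX := mdifferentiableAt_extend I E v
  have hZ := mdifferentiableAt_extend I E w
  have h1 := inner_leviCivitaFun g hY hX hZ
  rw [← h hX hZ] at h1
  simpa using h1

/-- The Levi-Civita connection of a smooth Riemannian metric. -/
def leviCivita (g : Metric I M) : CovariantDerivative I E (TangentSpace I : M → Type _) where
  toFun := leviCivitaFun g
  isCovariantDerivativeOnUniv :=
    { add := by
        intro Y Y' x hY hY' _
        refine leviCivitaFun_unique g (mdifferentiableAt_add_section hY hY') fun {X Z} hX hZ ↦ ?_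
        rw [koszul_add g hY hY' hX hZ, ← inner_leviCivitaFun g hY hX hZ,
          ← inner_leviCivitaFun g hY' hX hZ]
        simp
        ring
      leibniz := by
        intro Y f x hY hf _
        refine leviCivitaFun_unique g (hf.smul_section hY) fun {X Z} hX hZ ↦ ?_
        rw [koszul_smul g hY hf hX hZ, ← inner_leviCivitaFun g hY hX hZ]
        simp
        ring }

theorem inner_leviCivita (g : Metric I M) {Y X Z : Π x : M, TangentSpace I x} {x : M}
    (hY : MDiffAt (T% Y) x) (hX : MDiffAt (T% X) x) (hZ : MDiffAt (T% Z) x) :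
    2 * g.inner x (leviCivita g Y x (X x)) (Z x) = koszul g Y X Z x :=
  inner_leviCivitaFun g hY hX hZ

/-- The Levi-Civita connection is torsion-free. -/
theorem leviCivita_torsion (g : Metric I M) {X Y : Π x : M, TangentSpace I x} {x : M}
    (hX : MDiffAt (T% X) x) (hY : MDiffAt (T% Y) x) :
    leviCivita g Y x (X x) - leviCivita g X x (Y x) = mlieBracket I X Y x := by
  refine eq_of_inner_eq g fun w ↦ ?_
  have hZ := mdifferentiableAt_extend I E w
  have h1 := inner_leviCivita g hY hX hZ
  have h2 := inner_leviCivita g hX hY hZ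
  have e : (fun y ↦ g.inner y (X y) (Y y)) = fun y ↦ g.inner y (Y y) (X y) := by
    ext y; exact g.symm ..
  rw [koszul, mlieBracket_swap_apply (V := X) (W := Y)] at *
  simp only [e, extend_apply_self, map_neg, map_sub, neg_apply, sub_apply] at *
  linarith

/-- The Levi-Civita connection is compatible with the metric. -/
theorem leviCivita_metric (g : Metric I M) {X Y Z : Π x : M, TangentSpace I x} {x : M}
    (hX : MDiffAt (T% X) x) (hY : MDiffAt (T% Y) x) (hZ : MDiffAt (T% Z) x) :
    d% (fun y ↦ g.inner y (Y y) (Z y)) x (X x)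
      = g.inner x (leviCivita g Y x (X x)) (Z x) + g.inner x (Y x) (leviCivita g Z x (X x)) := by
  have h1 := inner_leviCivita g hY hX hZ
  have h2 := inner_leviCivita g hZ hX hY
  have e : (fun y ↦ g.inner y (Z y) (Y y)) = fun y ↦ g.inner y (Y y) (Z y) := by
    ext y; exact g.symm ..
  rw [g.symm x (Y x)]
  rw [koszul, mlieBracket_swap_apply (V := Z) (W := Y)] at *
  simp only [e, map_neg, neg_apply] at *
  linarith

end LeviCivita
/-! ### Almost contact metric structures -/

section Structure

/-- An almost contact metric structure on a manifold: a Riemannian metric `g`, a unit vector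
field `ξ` and a field `φ` of endomorphisms of the tangent spaces. The `1`-form `η` is the dual
of `ξ`, so that `η(X) = g(ξ, X)`. -/
structure AlmostContactMetricStructure {E : Type*} [NormedAddCommGroup E] [NormedSpace ℝ E]
    {H : Type*} [TopologicalSpace H] (I : ModelWithCorners ℝ E H) (M : Type*) [TopologicalSpace M]
    [ChartedSpace H M] [IsManifold I ∞ M] where
  /-- The Riemannian metric. -/
  g : Metric I M
  /-- The characteristic vector field. -/
  ξ : Π x : M, TangentSpace I x
  /-- The endomorphism field. -/
  φ : Π x : M, TangentSpace I x →L[ℝ] TangentSpace I x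
  contMDiff_ξ : CMDiff ∞ (T% ξ)
  contMDiff_φ : ContMDiff I (I.prod 𝓘(ℝ, E →L[ℝ] E)) ∞
    (fun x ↦ TotalSpace.mk' (E →L[ℝ] E) (E := fun x : M ↦ TangentSpace I x →L[ℝ] TangentSpace I x) x (φ x))
  unit_ξ (x : M) : g.inner x (ξ x) (ξ x) = 1
  φ_ξ (x : M) : φ x (ξ x) = 0
  φ_φ (x : M) (v : TangentSpace I x) : φ x (φ x v) = -v + g.inner x (ξ x) v • ξ x
  inner_φ_φ (x : M) (v w : TangentSpace I x) :
    g.inner x (φ x v) (φ x w) = g.inner x v w - g.inner x (ξ x) v * g.inner x (ξ x) w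

namespace AlmostContactMetricStructure

variable {E : Type*} [NormedAddCommGroup E] [NormedSpace ℝ E] [FiniteDimensional ℝ E]
  {H : Type*} [TopologicalSpace H] {I : ModelWithCorners ℝ E H}
  {M : Type*} [TopologicalSpace M] [ChartedSpace H M] [IsManifold I ∞ M]
  (S : AlmostContactMetricStructure I M)

/-- The `1`-form `η` dual to `ξ`. -/
def η (x : M) : TangentSpace I x →L[ℝ] ℝ := S.g.inner x (S.ξ x)

/-- The fundamental form `Φ(X, Y) = g(X, φ(Y))`. -/
def Φ (x : M) (v w : TangentSpace I x) : ℝ := S.g.inner x v (S.φ x w)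

/-- The Levi-Civita connection of `g`; `S.nabla Y x v` is `(∇_v Y)(x)`. -/
abbrev nabla : CovariantDerivative I E (TangentSpace I : M → Type _) := leviCivita S.g

theorem mdiffAt_ξ (x : M) : MDiffAt (T% S.ξ) x :=
  S.contMDiff_ξ.mdifferentiableAt (by simp)

theorem mdiffAt_φ {X : Π x : M, TangentSpace I x} {x : M} (hX : MDiffAt (T% X) x) :
    MDiffAt (T% (fun y ↦ S.φ y (X y))) x :=
  MDifferentiableAt.clm_bundle_apply (F₁ := E) (F₂ := E) (S.contMDiff_φ.mdifferentiableAt (by simp)) hX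

theorem mdiffAt_η {X : Π x : M, TangentSpace I x} {x : M} (hX : MDiffAt (T% X) x) :
    MDiffAt (fun y ↦ S.η y (X y)) x :=
  S.g.mdiffAt (S.mdiffAt_ξ x) hX

theorem mdiffAt_Φ {X Y : Π x : M, TangentSpace I x} {x : M} (hX : MDiffAt (T% X) x)
    (hY : MDiffAt (T% Y) x) : MDiffAt (fun y ↦ S.Φ y (X y) (Y y)) x :=
  S.g.mdiffAt hX (S.mdiffAt_φ hY)

/-- The `1`-form `v ↦ v(η(Y)) - η(∇_v Y)`, which is `v ↦ (∇_v η)(Y)`. -/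
def nablaEtaAux (Y : Π x : M, TangentSpace I x) (x : M) : TangentSpace I x →L[ℝ] ℝ :=
  d% (fun y ↦ S.η y (Y y)) x - S.η x ∘L S.nabla Y x

theorem tensorial_nablaEtaAux (x : M) :
    TensorialAt I E (S.nablaEtaAux · x) x where
  smul {f Y} hf hY := by
    have e : (fun y ↦ S.η y ((f • Y) y)) = f * fun y ↦ S.η y (Y y) := by ext y; simp
    simp only [nablaEtaAux, e]
    rw [mvfderiv_mul hf (S.mdiffAt_η hY), S.nabla.isCovariantDerivativeOn.leibniz hY hf]
    ext v
    simp
    ring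
  add {Y Y'} hY hY' := by
    have e : (fun y ↦ S.η y ((Y + Y') y)) = (fun y ↦ S.η y (Y y)) + fun y ↦ S.η y (Y' y) := by
      ext y; simp
    simp only [nablaEtaAux, e]
    rw [mvfderiv_add (S.mdiffAt_η hY) (S.mdiffAt_η hY'),
      S.nabla.isCovariantDerivativeOn.add hY hY']
    ext v
    simp
    ring

/-- The covariant derivative of `η`: `S.nablaEta x v w` is `(∇_v η)(w)`. -/
def nablaEta (x : M) (v w : TangentSpace I x) : ℝ :=
  TensorialAt.mkHom (S.nablaEtaAux · x) x (S.tensorial_nablaEtaAux x) w v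

theorem nablaEta_apply {X Y : Π x : M, TangentSpace I x} {x : M} (hY : MDiffAt (T% Y) x) :
    S.nablaEta x (X x) (Y x)
      = d% (fun y ↦ S.η y (Y y)) x (X x) - S.η x (S.nabla Y x (X x)) := by
  rw [nablaEta, TensorialAt.mkHom_apply _ hY]
  rfl

/-- The exterior derivative of `η`. -/
def dη (x : M) (v w : TangentSpace I x) : ℝ := S.nablaEta x v w - S.nablaEta x w v

/-- The `1`-form `v ↦ v(Φ(Y, Z)) - Φ(∇_v Y, Z) - Φ(Y, ∇_v Z)`, which is `v ↦ (∇_v Φ)(Y, Z)`. -/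
def nablaPhiAux (Y Z : Π x : M, TangentSpace I x) (x : M) : TangentSpace I x →L[ℝ] ℝ :=
  d% (fun y ↦ S.Φ y (Y y) (Z y)) x - S.g.inner x (S.φ x (Z x)) ∘L S.nabla Y x
    - S.g.inner x (Y x) ∘L S.φ x ∘L S.nabla Z x

theorem tensorial_nablaPhiAux_left {Z : Π x : M, TangentSpace I x} {x : M}
    (hZ : MDiffAt (T% Z) x) :
    TensorialAt I E (S.nablaPhiAux · Z x) x where
  smul {f Y} hf hY := by
    have e : (fun y ↦ S.Φ y ((f • Y) y) (Z y)) = f * fun y ↦ S.Φ y (Y y) (Z y) := by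
      ext y; simp [Φ]
    simp only [nablaPhiAux, e]
    rw [mvfderiv_mul hf (S.mdiffAt_Φ hY hZ), S.nabla.isCovariantDerivativeOn.leibniz hY hf]
    ext v
    simp [Φ, S.g.symm x (S.φ x (Z x)) (Y x)]
    ring
  add {Y Y'} hY hY' := by
    have e : (fun y ↦ S.Φ y ((Y + Y') y) (Z y))
        = (fun y ↦ S.Φ y (Y y) (Z y)) + fun y ↦ S.Φ y (Y' y) (Z y) := by
      ext y; simp [Φ]
    simp only [nablaPhiAux, e]
    rw [mvfderiv_add (S.mdiffAt_Φ hY hZ) (S.mdiffAt_Φ hY' hZ),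
      S.nabla.isCovariantDerivativeOn.add hY hY']
    ext v
    simp
    ring

theorem tensorial_nablaPhiAux_right {Y : Π x : M, TangentSpace I x} {x : M}
    (hY : MDiffAt (T% Y) x) :
    TensorialAt I E (S.nablaPhiAux Y · x) x where
  smul {f Z} hf hZ := by
    have e : (fun y ↦ S.Φ y (Y y) ((f • Z) y)) = f * fun y ↦ S.Φ y (Y y) (Z y) := by
      ext y; simp [Φ]
    simp only [nablaPhiAux, e]
    rw [mvfderiv_mul hf (S.mdiffAt_Φ hY hZ), S.nabla.isCovariantDerivativeOn.leibniz hZ hf]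
    ext v
    simp [Φ]
    ring
  add {Z Z'} hZ hZ' := by
    have e : (fun y ↦ S.Φ y (Y y) ((Z + Z') y))
        = (fun y ↦ S.Φ y (Y y) (Z y)) + fun y ↦ S.Φ y (Y y) (Z' y) := by
      ext y; simp [Φ]
    simp only [nablaPhiAux, e]
    rw [mvfderiv_add (S.mdiffAt_Φ hY hZ) (S.mdiffAt_Φ hY hZ'),
      S.nabla.isCovariantDerivativeOn.add hZ hZ']
    ext v
    simp
    ring

/-- The covariant derivative of `Φ`: `S.nablaPhi x u v w` is `(∇_u Φ)(v, w)`. -/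
def nablaPhi (x : M) (u v w : TangentSpace I x) : ℝ :=
  TensorialAt.mkHom₂ (S.nablaPhiAux · · x) x (fun _ hZ ↦ S.tensorial_nablaPhiAux_left hZ)
    (fun _ hY ↦ S.tensorial_nablaPhiAux_right hY) v w u

theorem nablaPhi_apply {X Y Z : Π x : M, TangentSpace I x} {x : M} (hY : MDiffAt (T% Y) x)
    (hZ : MDiffAt (T% Z) x) :
    S.nablaPhi x (X x) (Y x) (Z x)
      = d% (fun y ↦ S.Φ y (Y y) (Z y)) x (X x) - S.Φ x (S.nabla Y x (X x)) (Z x)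
        - S.Φ x (Y x) (S.nabla Z x (X x)) := by
  rw [nablaPhi, TensorialAt.mkHom₂_apply _ _ hY hZ]
  simp [nablaPhiAux, Φ, S.g.symm x (S.φ x (Z x))]

/-- The exterior derivative of `Φ`. -/
def dΦ (x : M) (u v w : TangentSpace I x) : ℝ :=
  S.nablaPhi x u v w - S.nablaPhi x v u w + S.nablaPhi x w u v

/-- The vector field `[φX, φY] + φ²[X, Y] - φ[φX, Y] - φ[X, φY]`. -/
def nijenhuisAux (X Y : Π x : M, TangentSpace I x) (x : M) : TangentSpace I x :=
  mlieBracket I (fun y ↦ S.φ y (X y)) (fun y ↦ S.φ y (Y y)) x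
    + S.φ x (S.φ x (mlieBracket I X Y x))
    - S.φ x (mlieBracket I (fun y ↦ S.φ y (X y)) Y x)
    - S.φ x (mlieBracket I X (fun y ↦ S.φ y (Y y)) x)

theorem nijenhuisAux_swap (X Y : Π x : M, TangentSpace I x) (x : M) :
    S.nijenhuisAux X Y x = -S.nijenhuisAux Y X x := by
  simp only [nijenhuisAux]
  rw [mlieBracket_swap_apply (V := X) (W := Y), mlieBracket_swap_apply (V := X),
    mlieBracket_swap_apply (V := fun y ↦ S.φ y (X y)) (W := Y),
    mlieBracket_swap_apply (V := fun y ↦ S.φ y (X y))]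
  simp
  abel

theorem tensorial_nijenhuisAux_left {Y : Π x : M, TangentSpace I x} {x : M}
    (_hY : MDiffAt (T% Y) x) :
    TensorialAt I E (S.nijenhuisAux · Y x) x where
  smul {f X} hf hX := by
    have e : (fun y ↦ S.φ y ((f • X) y)) = f • fun y ↦ S.φ y (X y) := by ext1 y; simp
    simp only [nijenhuisAux, e]
    rw [mlieBracket_smul_left hf hX, mlieBracket_smul_left hf hX,
      mlieBracket_smul_left hf (S.mdiffAt_φ hX), mlieBracket_smul_left hf (S.mdiffAt_φ hX)]
    simp
    module
  add {X X'} hX hX' := by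
    have e : (fun y ↦ S.φ y ((X + X') y)) = (fun y ↦ S.φ y (X y)) + fun y ↦ S.φ y (X' y) := by
      ext1 y; simp
    simp only [nijenhuisAux, e]
    rw [mlieBracket_add_left hX hX', mlieBracket_add_left hX hX',
      mlieBracket_add_left (S.mdiffAt_φ hX) (S.mdiffAt_φ hX'),
      mlieBracket_add_left (S.mdiffAt_φ hX) (S.mdiffAt_φ hX')]
    simp
    abel

theorem tensorial_nijenhuisAux_right {X : Π x : M, TangentSpace I x} {x : M}
    (hX : MDiffAt (T% X) x) :
    TensorialAt I E (S.nijenhuisAux X · x) x where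
  smul hf hY := by
    simp only [S.nijenhuisAux_swap X]
    rw [(S.tensorial_nijenhuisAux_left hX).smul hf hY, smul_neg]
  add hY hY' := by
    simp only [S.nijenhuisAux_swap X]
    rw [(S.tensorial_nijenhuisAux_left hX).add hY hY', neg_add]

/-- The Nijenhuis torsion `[φ, φ]` of `φ`. -/
def nijenhuisTorsion (x : M) :
    TangentSpace I x →L[ℝ] TangentSpace I x →L[ℝ] TangentSpace I x :=
  TensorialAt.mkHom₂ (S.nijenhuisAux · · x) x (fun _ hY ↦ S.tensorial_nijenhuisAux_left hY)
    (fun _ hX ↦ S.tensorial_nijenhuisAux_right hX)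

theorem nijenhuisTorsion_apply {X Y : Π x : M, TangentSpace I x} {x : M}
    (hX : MDiffAt (T% X) x) (hY : MDiffAt (T% Y) x) :
    S.nijenhuisTorsion x (X x) (Y x)
      = mlieBracket I (fun y ↦ S.φ y (X y)) (fun y ↦ S.φ y (Y y)) x
        + S.φ x (S.φ x (mlieBracket I X Y x))
        - S.φ x (mlieBracket I (fun y ↦ S.φ y (X y)) Y x)
        - S.φ x (mlieBracket I X (fun y ↦ S.φ y (Y y)) x) :=
  TensorialAt.mkHom₂_apply _ _ hX hY

/-- The Nijenhuis tensor `N(X, Y, Z) = g(X, [φ, φ](Y, Z)) + η(X) dη(Y, Z)`. -/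
def N (x : M) (u v w : TangentSpace I x) : ℝ :=
  S.g.inner x u (S.nijenhuisTorsion x v w) + S.η x u * S.dη x v w

/-- `γ(X, Y) = dΦ(ξ, φ(X), Y)`. -/
def γ (x : M) (v w : TangentSpace I x) : ℝ := S.dΦ x (S.ξ x) (S.φ x v) w

/-- The `3`-form `dη ∧ η`. -/
def dηWedgeη (x : M) (u v w : TangentSpace I x) : ℝ :=
  S.dη x u v * S.η x w + S.dη x v w * S.η x u + S.dη x w u * S.η x v

/-- `ξ` is a Killing vector field, i.e. the Lie derivative of `g` along `ξ` vanishes. -/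
def IsKilling : Prop :=
  ∀ (x : M) (X Y : Π x : M, TangentSpace I x), MDiffAt (T% X) x → MDiffAt (T% Y) x →
    d% (fun y ↦ S.g.inner y (X y) (Y y)) x (S.ξ x)
      - S.g.inner x (mlieBracket I S.ξ X x) (Y x)
      - S.g.inner x (X x) (mlieBracket I S.ξ Y x) = 0

/-- Generalized quasi-Sasaki manifolds. -/
def IsGeneralizedQuasiSasaki : Prop :=
  (∀ (x : M) (u v w : TangentSpace I x), S.η x u = 0 → S.η x v = 0 → S.η x w = 0 →
    S.N x u v w = 0 ∧ S.dΦ x u v w = 0) ∧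
  S.IsKilling

/-- `N` is totally skew-symmetric. Since `N` is skew-symmetric in its last two arguments,
this is skew-symmetry in the first two arguments. -/
def IsTotallySkew : Prop :=
  ∀ (x : M) (u v w : TangentSpace I x), S.N x u v w + S.N x v u w = 0

/-- `N` is traceless cyclic. -/
def IsTracelessCyclic : Prop :=
  (∀ (x : M) (u v w : TangentSpace I x), S.N x u v w + S.N x v w u + S.N x w u v = 0) ∧
  (∀ (x : M) (e : Fin 5 → TangentSpace I x),
    (∀ i j, S.g.inner x (e i) (e j) = if i = j then 1 else 0) →
    ∀ u : TangentSpace I x, ∑ i, S.N x (e i) (e i) u = 0)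

end AlmostContactMetricStructure

end Structure

/-! ### The `U(2)`-modules of intrinsic torsion tensors

A `2`-form `β` on `ℝ⁵` is identified with the skew-symmetric matrix with entries `β(e_i, e_j)`,
a `(3,0)`-tensor `A` with the array of its components `A(e_i, e_j, e_k)`. -/

section Model

/-- Components of `(3,0)`-tensors on `ℝ⁵`. -/
abbrev Tensor3 := Fin 5 → Fin 5 → Fin 5 → ℝ

/-- The components of the model `1`-form `η = e₅`. -/
def eta0 : Fin 5 → ℝ := ![0, 0, 0, 0, 1]

/-- The components of the model fundamental form `Φ = e₁ ∧ e₂ + e₃ ∧ e₄`. As `Φ(X, Y) = g(X, φ(Y))`,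
this is also the matrix of the model endomorphism `φ`. -/
def Phi0 : Matrix (Fin 5) (Fin 5) ℝ :=
  !![0, 1, 0, 0, 0; -1, 0, 0, 0, 0; 0, 0, 0, 1, 0; 0, 0, -1, 0, 0; 0, 0, 0, 0, 0]

/-- The Lie algebra `u(2)` inside `so(5)`: the skew-symmetric matrices commuting with `φ`
(these automatically annihilate `ξ = e₅`). -/
def u2 : Submodule ℝ (Matrix (Fin 5) (Fin 5) ℝ) where
  carrier := {A | A.transpose = -A ∧ A * Phi0 = Phi0 * A}
  zero_mem' := by simp
  add_mem' := by
    rintro A B ⟨hA, hA'⟩ ⟨hB, hB'⟩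
    refine ⟨?_, ?_⟩
    · rw [Matrix.transpose_add, hA, hB, neg_add]
    · rw [add_mul, mul_add, hA', hB']
  smul_mem' := by
    rintro c A ⟨hA, hA'⟩
    refine ⟨?_, ?_⟩
    · rw [Matrix.transpose_smul, hA, smul_neg]
    · rw [smul_mul_assoc, mul_smul_comm, hA']

/-- The orthogonal projection of `so(5)` onto `u(2)^⊥` (see `sub_prPerp_mem` and
`trace_prPerp_mul`). -/
def prPerp (A : Matrix (Fin 5) (Fin 5) ℝ) : Matrix (Fin 5) (Fin 5) ℝ :=
  A - (1 / 2 : ℝ) • (Phi0 * Phi0 * A * Phi0 * Phi0 - Phi0 * A * Phi0)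

theorem Phi0_transpose : Phi0.transpose = -Phi0 := by
  ext i j; fin_cases i <;> fin_cases j <;> simp [Phi0]

theorem Phi0_cube : Phi0 * Phi0 * Phi0 = -Phi0 := by
  ext i j
  fin_cases i <;> fin_cases j <;> simp [Phi0, Matrix.mul_apply, Fin.sum_univ_five]

/-- `A - prPerp A` belongs to `u(2)`. -/
theorem sub_prPerp_mem {A : Matrix (Fin 5) (Fin 5) ℝ} (hA : A.transpose = -A) :
    A - prPerp A ∈ u2 := by
  have h1 : A - prPerp A
      = (1 / 2 : ℝ) • (Phi0 * Phi0 * A * Phi0 * Phi0 - Phi0 * A * Phi0) := by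
    simp [prPerp]
  rw [h1]
  refine u2.smul_mem _ ⟨?_, ?_⟩
  · simp only [Matrix.transpose_sub, Matrix.transpose_mul, Phi0_transpose, hA]
    noncomm_ring
  · have e1 : (Phi0 * Phi0 * A * Phi0 * Phi0 - Phi0 * A * Phi0) * Phi0
        = Phi0 * Phi0 * A * (Phi0 * Phi0 * Phi0) - Phi0 * A * Phi0 * Phi0 := by noncomm_ring
    have e2 : Phi0 * (Phi0 * Phi0 * A * Phi0 * Phi0 - Phi0 * A * Phi0)
        = (Phi0 * Phi0 * Phi0) * A * Phi0 * Phi0 - Phi0 * Phi0 * A * Phi0 := by noncomm_ring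
    rw [e1, e2, Phi0_cube]
    noncomm_ring

theorem Phi0_sq_mul {B : Matrix (Fin 5) (Fin 5) ℝ} (hB : B ∈ u2) : Phi0 * Phi0 * B = -B := by
  obtain ⟨h1, h2⟩ := hB
  have h1' : ∀ i j, B j i = -B i j := fun i j ↦ congr($h1 i j)
  have h2' : ∀ i j, (B * Phi0) i j = (Phi0 * B) i j := fun i j ↦ congr($h2 i j)
  have a1 := h2' 0 4
  have a2 := h2' 1 4
  have a3 := h2' 2 4
  have a4 := h2' 3 4
  have a5 := h1' 4 4
  have a6 := h1' 4 0
  have a7 := h1' 4 1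
  have a8 := h1' 4 2
  have a9 := h1' 4 3
  simp [Phi0, Matrix.mul_apply, Fin.sum_univ_five] at a1 a2 a3 a4
  ext i j
  fin_cases i <;> fin_cases j <;> simp [Phi0, Matrix.mul_apply, Fin.sum_univ_five] <;> linarith

/-- `prPerp A` is orthogonal to `u(2)` with respect to `⟨x, y⟩ = -(1/2) tr(xy)`. -/
theorem trace_prPerp_mul (A : Matrix (Fin 5) (Fin 5) ℝ) {B : Matrix (Fin 5) (Fin 5) ℝ}
    (hB : B ∈ u2) : (prPerp A * B).trace = 0 := by
  have hc := hB.2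
  have h2 := Phi0_sq_mul hB
  have e1 : Phi0 * Phi0 * A * Phi0 * Phi0 * B = Phi0 * Phi0 * (A * (Phi0 * Phi0 * B)) := by
    noncomm_ring
  have e2 : Phi0 * A * Phi0 * B = Phi0 * (A * (Phi0 * B)) := by noncomm_ring
  have e3 : A * -B * (Phi0 * Phi0) = -(A * (B * Phi0 * Phi0)) := by noncomm_ring
  have e4 : Phi0 * B * Phi0 = Phi0 * Phi0 * B := by rw [mul_assoc, hc, mul_assoc]
  have e5 : A * (Phi0 * B) * Phi0 = A * (Phi0 * B * Phi0) := by noncomm_ring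
  rw [prPerp, sub_mul, smul_mul_assoc, sub_mul, e1, e2, h2, Matrix.trace_sub, Matrix.trace_smul,
    Matrix.trace_sub, Matrix.trace_mul_comm (Phi0 * Phi0), Matrix.trace_mul_comm Phi0, e3, e5,
    hc, e4, h2]
  simp
  ring

/-- `1` if `i < j`, `-1` if `j < i`, and `0` if `i = j`. -/
def sgn (i j : Fin 5) : ℤ := if i < j then 1 else if j < i then -1 else 0

/-- The Levi-Civita symbol: the value of the volume form `e₁ ∧ … ∧ e₅` on `(e_i, e_j, e_k, e_l, e_m)`,
i.e. the sign of `(i, j, k, l, m)` if this is a permutation and `0` otherwise. -/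
def eps (i j k l m : Fin 5) : ℤ :=
  sgn i j * sgn i k * sgn i l * sgn i m * sgn j k * sgn j l * sgn j m * sgn k l * sgn k m * sgn l m

/-- The Hodge operator on `2`-forms, `(∗β)_{klm} = (1/2) ∑_{i,j} β_{ij} ε_{ijklm}`. -/
def hodge : Matrix (Fin 5) (Fin 5) ℝ →ₗ[ℝ] Tensor3 where
  toFun β k l m := (1 / 2) * ∑ i, ∑ j, (eps i j k l m : ℝ) * β i j
  map_add' β β' := by
    funext k l m
    simp only [Pi.add_apply, Matrix.add_apply, mul_add, Finset.sum_add_distrib]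
  map_smul' c β := by
    funext k l m
    simp only [Pi.smul_apply, Matrix.smul_apply, smul_eq_mul, Finset.mul_sum, RingHom.id_apply]
    refine Finset.sum_congr rfl fun i _ ↦ Finset.sum_congr rfl fun j _ ↦ by ring

/-- The components of the `3`-form `η ∧ β`. -/
def etaWedge (β : Matrix (Fin 5) (Fin 5) ℝ) : Tensor3 := fun k l m ↦
  eta0 k * β l m + eta0 l * β m k + eta0 m * β k l

/-- The components of the `4`-form `Φ ∧ β`. -/
def PhiWedge (β : Matrix (Fin 5) (Fin 5) ℝ) (i j k l : Fin 5) : ℝ :=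
  Phi0 i j * β k l - Phi0 i k * β j l + Phi0 i l * β j k
    + Phi0 j k * β i l - Phi0 j l * β i k + Phi0 k l * β i j

/-- The module `Λ²₂ = {β | Φ ∧ β = 0, ∗β = η ∧ β}`. -/
def Lambda22 : Submodule ℝ (Matrix (Fin 5) (Fin 5) ℝ) where
  carrier := {β | β.transpose = -β ∧ (∀ i j k l, PhiWedge β i j k l = 0) ∧ hodge β = etaWedge β}
  zero_mem' := by
    refine ⟨by simp, by simp [PhiWedge], ?_⟩
    rw [map_zero]; funext k l m; simp [etaWedge]
  add_mem' := by
    rintro A B ⟨hA, hA', hA''⟩ ⟨hB, hB', hB''⟩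
    refine ⟨?_, fun i j k l ↦ ?_, ?_⟩
    · rw [Matrix.transpose_add, hA, hB, neg_add]
    · have h1 := hA' i j k l
      have h2 := hB' i j k l
      simp only [PhiWedge, Matrix.add_apply] at *
      linarith
    · rw [map_add, hA'', hB'']
      funext k l m
      simp only [etaWedge, Pi.add_apply, Matrix.add_apply]
      ring
  smul_mem' := by
    rintro c A ⟨hA, hA', hA''⟩
    refine ⟨?_, fun i j k l ↦ ?_, ?_⟩
    · rw [Matrix.transpose_smul, hA, smul_neg]
    · have h1 := hA' i j k l
      simp only [PhiWedge, Matrix.smul_apply, smul_eq_mul] at *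
      linear_combination c * h1
    · rw [map_smul, hA'']
      funext k l m
      simp only [etaWedge, Pi.smul_apply, Matrix.smul_apply, smul_eq_mul]
      ring

/-- The map `θ(β) = ∗β`. -/
def theta : Matrix (Fin 5) (Fin 5) ℝ →ₗ[ℝ] Tensor3 := hodge

/-- The map `ϑ(β)(X, Y, Z) = 3 η(X) β(Y, Z) - ∗β(X, Y, Z)`. -/
def vartheta : Matrix (Fin 5) (Fin 5) ℝ →ₗ[ℝ] Tensor3 where
  toFun β k l m := 3 * eta0 k * β l m - hodge β k l m
  map_add' β β' := by
    funext k l m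
    simp only [map_add, Pi.add_apply, Matrix.add_apply]
    ring
  map_smul' c β := by
    funext k l m
    simp only [map_smul, Pi.smul_apply, Matrix.smul_apply, smul_eq_mul, RingHom.id_apply]
    ring

/-- The module `W₄ = θ(Λ²₂)`. -/
def W4 : Submodule ℝ Tensor3 := Lambda22.map theta

/-- The module `W₇ = ϑ(Λ²₂)`. -/
def W7 : Submodule ℝ Tensor3 := Lambda22.map vartheta

end Model

/-! ### Intrinsic torsion -/

section Intrinsic

namespace AlmostContactMetricStructure

variable {E : Type*} [NormedAddCommGroup E] [NormedSpace ℝ E] [FiniteDimensional ℝ E]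
  {H : Type*} [TopologicalSpace H] {I : ModelWithCorners ℝ E H}
  {M : Type*} [TopologicalSpace M] [ChartedSpace H M] [IsManifold I ∞ M]
  (S : AlmostContactMetricStructure I M)

/-- A smooth adapted frame on a neighbourhood of `x`: an orthonormal frame `(e₁, …, e₅)`
(indexed here by `0, …, 4`) with `η = e₅` and `Φ = e₁ ∧ e₂ + e₃ ∧ e₄`. -/
structure AdaptedFrame (x : M) where
  /-- The neighbourhood. -/
  U : Set M
  /-- The vector fields of the frame; only their values on `U` matter. -/
  e : Fin 5 → Π y : M, TangentSpace I y
  isOpen : IsOpen U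
  mem : x ∈ U
  contMDiffOn (i : Fin 5) : CMDiff[U] ∞ (T% (e i))
  orthonormal (y : M) (hy : y ∈ U) (i j : Fin 5) :
    S.g.inner y (e i y) (e j y) = if i = j then 1 else 0
  eta (y : M) (hy : y ∈ U) (i : Fin 5) : S.η y (e i y) = eta0 i
  fundamental (y : M) (hy : y ∈ U) (i j : Fin 5) : S.Φ y (e i y) (e j y) = Phi0 i j

variable {S}

/-- The connection form `ω_{ij}(v) = g(∇_v e_i, e_j)` at `x`, with values in `so(5)`. -/
def connectionForm {x : M} (F : S.AdaptedFrame x) (v : TangentSpace I x) :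
    Matrix (Fin 5) (Fin 5) ℝ :=
  Matrix.of fun i j ↦ S.g.inner x (S.nabla (F.e i) x v) (F.e j x)

/-- The components `Γ(e_k)_{ij}` of the intrinsic torsion at `x`, where `Γ(X)` is
the projection of the connection form to `u(2)^⊥`. -/
def intrinsicTorsion {x : M} (F : S.AdaptedFrame x) : Tensor3 := fun k i j ↦
  prPerp (connectionForm F (F.e k x)) i j

variable (S)

/-- The almost contact metric manifold is of class `W`, for a `U(2)`-submodule `W` of the space of
intrinsic torsion tensors: at each point, the intrinsic torsion belongs to `W`. -/
def IsOfClass (W : Submodule ℝ Tensor3) : Prop :=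
  ∀ x : M, ∃ F : S.AdaptedFrame x, intrinsicTorsion F ∈ W

end AlmostContactMetricStructure

end Intrinsic

end ACM

end

noncomputable section

namespace ACM

section Tensors
namespace AlmostContactMetricStructure

variable {E : Type*} [NormedAddCommGroup E] [NormedSpace ℝ E] [FiniteDimensional ℝ E]
  {H : Type*} [TopologicalSpace H] {I : ModelWithCorners ℝ E H}
  {M : Type*} [TopologicalSpace M] [ChartedSpace H M] [IsManifold I ∞ M]
  (S : AlmostContactMetricStructure I M)

theorem η_φ (x : M) (v : TangentSpace I x) : S.g.inner x (S.ξ x) (S.φ x v) = 0 := by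
  have h1 := S.φ_φ x (S.φ x v)
  rw [congrArg (S.φ x) (S.φ_φ x v), map_add, map_neg, map_smul, S.φ_ξ, smul_zero, add_zero, left_eq_add] at h1
  simpa [S.unit_ξ] using congr(S.g.inner x (S.ξ x) $h1)

theorem inner_φ_left (x : M) (v w : TangentSpace I x) :
    S.g.inner x (S.φ x v) w = -S.g.inner x v (S.φ x w) := by
  have h := S.inner_φ_φ x v (S.φ x w)
  rw [S.φ_φ, S.η_φ, map_add, map_neg, map_smul, S.g.symm x (S.φ x v) (S.ξ x), S.η_φ] at h
  simp only [smul_eq_mul, mul_zero, add_zero, sub_zero] at h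
  linarith

theorem nablaEta_eq_inner (x : M) (v w : TangentSpace I x) :
    S.nablaEta x v w = S.g.inner x (S.nabla S.ξ x v) w := by
  have hX := mdifferentiableAt_extend I E v
  have hY := mdifferentiableAt_extend I E w
  have h := S.nablaEta_apply (X := extend E v) hY
  have h2 := leviCivita_metric S.g hX (S.mdiffAt_ξ x) hY
  simp only [η, nabla, extend_apply_self] at h h2 ⊢
  rw [h, h2]
  ring

theorem nablaPhi_eq_inner {Z : Π x : M, TangentSpace I x} {x : M} (hZ : MDiffAt (T% Z) x)
    (u v : TangentSpace I x) :
    S.nablaPhi x u v (Z x)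
      = S.g.inner x v (S.nabla (fun y ↦ S.φ y (Z y)) x u - S.φ x (S.nabla Z x u)) := by
  have hX := mdifferentiableAt_extend I E u
  have hY := mdifferentiableAt_extend I E v
  have h := S.nablaPhi_apply (X := extend E u) hY hZ
  have h2 := leviCivita_metric S.g hX hY (S.mdiffAt_φ hZ)
  simp only [Φ, nabla, extend_apply_self, map_sub] at h h2 ⊢
  rw [h, h2]
  ring

theorem isKilling_iff :
    S.IsKilling ↔ ∀ (x : M) (v w : TangentSpace I x), S.nablaEta x v w + S.nablaEta x w v = 0 := by
  have key (x : M) (X Y : Π x : M, TangentSpace I x) (hX : MDiffAt (T% X) x)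
      (hY : MDiffAt (T% Y) x) : d% (fun y ↦ S.g.inner y (X y) (Y y)) x (S.ξ x)
      - S.g.inner x (mlieBracket I S.ξ X x) (Y x)
      - S.g.inner x (X x) (mlieBracket I S.ξ Y x)
      = S.nablaEta x (X x) (Y x) + S.nablaEta x (Y x) (X x) := by
    rw [leviCivita_metric S.g (S.mdiffAt_ξ x) hX hY, ← leviCivita_torsion S.g (S.mdiffAt_ξ x) hX,
      ← leviCivita_torsion S.g (S.mdiffAt_ξ x) hY, nablaEta_eq_inner, nablaEta_eq_inner]
    simp only [map_sub, sub_apply, S.g.symm x (leviCivita S.g S.ξ x (Y x))]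
    ring
  refine ⟨fun h x v w ↦ ?_, fun h x X Y hX hY ↦ ?_⟩
  · have hX := mdifferentiableAt_extend I E v
    have hY := mdifferentiableAt_extend I E w
    have := h x _ _ hX hY
    rw [key x _ _ hX hY] at this
    simpa using this
  · rw [key x X Y hX hY, h]

theorem N_eq (x : M) (u v w : TangentSpace I x) :
    S.N x u v w = S.nablaPhi x (S.φ x v) u w - S.nablaPhi x (S.φ x w) u v
      - S.nablaPhi x w (S.φ x u) v + S.nablaPhi x v (S.φ x u) w + S.η x u * S.dη x v w := by
  have hX := mdifferentiableAt_extend I E v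
  have hY := mdifferentiableAt_extend I E w
  have h := S.nijenhuisTorsion_apply hX hY
  have h1 := S.nablaPhi_eq_inner hX
  have h2 := S.nablaPhi_eq_inner hY
  rw [← leviCivita_torsion S.g hX hY, ← leviCivita_torsion S.g (S.mdiffAt_φ hX) hY,
    ← leviCivita_torsion S.g hX (S.mdiffAt_φ hY),
    ← leviCivita_torsion S.g (S.mdiffAt_φ hX) (S.mdiffAt_φ hY)] at h
  simp only [extend_apply_self] at h h1 h2
  rw [N, h, h1, h1, h2, h2, S.inner_φ_left, S.inner_φ_left]
  simp only [nabla, map_sub, map_add]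
  ring

end AlmostContactMetricStructure
end Tensors

section Frames

variable {E : Type*} [NormedAddCommGroup E] [NormedSpace ℝ E] [FiniteDimensional ℝ E]
  {H : Type*} [TopologicalSpace H] {I : ModelWithCorners ℝ E H}
  {M : Type*} [TopologicalSpace M] [ChartedSpace H M] [IsManifold I ∞ M]

theorem sum_inner_smul (hE : Module.finrank ℝ E = 5) (g : Metric I M) {x : M}
    {e : Fin 5 → TangentSpace I x} (he : ∀ i j, g.inner x (e i) (e j) = if i = j then 1 else 0)
    (u : TangentSpace I x) : ∑ i, g.inner x (e i) u • e i = u := by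
  have hli : LinearIndependent ℝ e := by
    rw [Fintype.linearIndependent_iff]
    intro c hc i
    simpa [he] using congr(g.inner x (e i) $hc)
  have hc : Fintype.card (Fin 5) = Module.finrank ℝ (TangentSpace I x) := by
    rw [Fintype.card_fin]; exact hE.symm
  have hspan := hli.span_eq_top_of_card_eq_finrank' hc
  obtain ⟨c, rfl⟩ := (Submodule.mem_span_range_iff_exists_fun ℝ).1
    (hspan ▸ Submodule.mem_top : u ∈ Submodule.span ℝ (Set.range e))
  simp [he]

theorem mvfderiv_eq_zero_of_eqOn {f : M → ℝ} {U : Set M} {c : ℝ} {x : M} (hU : U ∈ 𝓝 x)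
    (h : ∀ y ∈ U, f y = c) : d% f x = 0 := by
  unfold mvfderiv
  rw [(Filter.eventuallyEq_of_mem hU h : f =ᶠ[𝓝 x] fun _ ↦ c).mfderiv_eq, mfderiv_const]
  exact ContinuousLinearMap.comp_zero _

namespace AlmostContactMetricStructure

variable {S : AlmostContactMetricStructure I M} {x : M} (F : S.AdaptedFrame x)

namespace AdaptedFrame

theorem mem_nhds : F.U ∈ 𝓝 x := F.isOpen.mem_nhds F.mem

theorem mdiffAt (i : Fin 5) : MDiffAt (T% (F.e i)) x :=
  ((F.contMDiffOn i).contMDiffAt F.mem_nhds).mdifferentiableAt (by simp)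

theorem inner_e (i j : Fin 5) : S.g.inner x (F.e i x) (F.e j x) = if i = j then 1 else 0 :=
  F.orthonormal x F.mem i j

theorem e_four : F.e 4 x = S.ξ x := by
  have h1 := F.eta x F.mem 4
  have h2 := F.inner_e 4 4
  have h3 := S.unit_ξ x
  have h4 := S.g.symm x (F.e 4 x) (S.ξ x)
  simp only [η, eta0] at h1 h2
  by_contra h
  have := S.g.pos x _ (sub_ne_zero.2 h)
  simp only [map_sub, sub_apply, h1, h2, h3, h4] at this
  simp at this

theorem φ_e (hE : Module.finrank ℝ E = 5) (j : Fin 5) :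
    S.φ x (F.e j x) = ∑ l, Phi0 l j • F.e l x := by
  rw [← sum_inner_smul hE S.g F.inner_e (S.φ x (F.e j x))]
  exact Finset.sum_congr rfl fun l _ ↦ by rw [← F.fundamental x F.mem]; rfl

end AdaptedFrame

theorem connectionForm_transpose (v : TangentSpace I x) :
    (connectionForm F v).transpose = -connectionForm F v := by
  ext i j
  have h := leviCivita_metric S.g (mdifferentiableAt_extend I E v) (F.mdiffAt i) (F.mdiffAt j)
  rw [mvfderiv_eq_zero_of_eqOn F.mem_nhds fun y hy ↦ F.orthonormal y hy i j,
    S.g.symm x (F.e i x)] at h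
  simp [connectionForm] at h ⊢
  linarith

theorem nablaEta_frame (v : TangentSpace I x) (j : Fin 5) :
    S.nablaEta x v (F.e j x) = connectionForm F v 4 j := by
  have h := S.nablaEta_apply (X := extend E v) (F.mdiffAt j)
  rw [mvfderiv_eq_zero_of_eqOn F.mem_nhds fun y hy ↦ F.eta y hy j] at h
  have h2 := congr($(connectionForm_transpose F v) 4 j)
  simp only [connectionForm, extend_apply_self, η, ← F.e_four, Matrix.transpose_apply,
    Matrix.neg_apply, Matrix.of_apply, zero_apply, zero_sub] at h h2 ⊢
  rw [h, S.g.symm, h2, neg_neg]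

theorem nablaPhi_frame (hE : Module.finrank ℝ E = 5) (v : TangentSpace I x) (i j : Fin 5) :
    S.nablaPhi x v (F.e i x) (F.e j x)
      = (Phi0 * connectionForm F v - connectionForm F v * Phi0) i j := by
  have h := S.nablaPhi_apply (X := extend E v) (F.mdiffAt i) (F.mdiffAt j)
  rw [mvfderiv_eq_zero_of_eqOn F.mem_nhds fun y hy ↦ F.fundamental y hy i j] at h
  have h2 (w : TangentSpace I x) (j : Fin 5) : S.Φ x w (F.e j x)
      = ∑ l, Phi0 l j * S.g.inner x w (F.e l x) := by
    simp [Φ, F.φ_e hE]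
  have h3 (w : TangentSpace I x) (j : Fin 5) : S.Φ x (F.e j x) w = -S.Φ x w (F.e j x) := by
    simp only [Φ, S.g.symm x w, S.inner_φ_left, neg_neg]
  have h4 (i j : Fin 5) : Phi0 i j = -Phi0 j i := congr($Phi0_transpose j i)
  have h5 (i j : Fin 5) := congr($(connectionForm_transpose F v) i j)
  rw [h3, h2, h2] at h
  simp only [connectionForm, extend_apply_self, Matrix.transpose_apply, Matrix.sub_apply,
    Matrix.mul_apply, Matrix.neg_apply, Matrix.of_apply, zero_apply, zero_sub] at h h5 ⊢
  simp only [h, mul_comm (Phi0 _ j), h4 i, h5 j, neg_mul, mul_neg, Finset.sum_neg_distrib]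
  ring_nf

end AlmostContactMetricStructure
end Frames

section ModelComponents

/-- The general element of `u(2)^⊥`. -/
def perpBlock (p q : ℝ) (a : Fin 4 → ℝ) : Matrix (Fin 5) (Fin 5) ℝ :=
  !![0, 0, p, q, a 0; 0, 0, q, -p, a 1; -p, -q, 0, 0, a 2; -q, p, 0, 0, a 3;
    -a 0, -a 1, -a 2, -a 3, 0]

theorem Phi0_mul_apply (A : Matrix (Fin 5) (Fin 5) ℝ) (i j : Fin 5) :
    (Phi0 * A) i j = ![A 1 j, -A 0 j, A 3 j, -A 2 j, 0] i := by
  fin_cases i <;> simp [Phi0, Matrix.mul_apply, Fin.sum_univ_five]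

theorem mul_Phi0_apply (A : Matrix (Fin 5) (Fin 5) ℝ) (i j : Fin 5) :
    (A * Phi0) i j = ![-A i 1, A i 0, -A i 3, A i 2, 0] j := by
  fin_cases j <;> simp [Phi0, Matrix.mul_apply, Fin.sum_univ_five]

theorem prPerp_eq_perpBlock {A : Matrix (Fin 5) (Fin 5) ℝ} (hA : A.transpose = -A) :
    prPerp A = perpBlock ((A 0 2 - A 1 3) / 2) ((A 0 3 + A 1 2) / 2)
      ![A 0 4, A 1 4, A 2 4, A 3 4] := by
  have h (i j) : A i j = -A j i := congr($hA j i)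
  ext i j
  fin_cases i <;> fin_cases j <;>
    simp [prPerp, perpBlock, mul_assoc Phi0 Phi0, Phi0_mul_apply, mul_Phi0_apply] <;>
    linarith [h 0 0, h 1 1, h 2 2, h 3 3, h 4 4, h 0 1, h 0 2, h 0 3, h 0 4, h 1 2, h 1 3, h 1 4,
      h 2 3, h 2 4, h 3 4]

theorem prPerp_four {A : Matrix (Fin 5) (Fin 5) ℝ} (hA : A.transpose = -A) (j : Fin 5) :
    prPerp A 4 j = A 4 j := by
  have h (i j) : A i j = -A j i := congr($hA j i)
  rw [prPerp_eq_perpBlock hA]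
  fin_cases j <;> simp [perpBlock] <;> linarith [h 4 0, h 4 1, h 4 2, h 4 3, h 4 4]

theorem commutator_prPerp {A : Matrix (Fin 5) (Fin 5) ℝ} (hA : A.transpose = -A) :
    Phi0 * prPerp A - prPerp A * Phi0 = Phi0 * A - A * Phi0 := by
  have h := (sub_prPerp_mem hA).2
  rw [sub_mul, mul_sub, sub_eq_sub_iff_add_eq_add] at h
  rw [sub_eq_sub_iff_add_eq_add, add_comm, ← h, add_comm]

/-- The components of `∇Φ` in terms of those of the intrinsic torsion. -/
def modelNablaPhi (T : Tensor3) (k i j : Fin 5) : ℝ :=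
  (Phi0 * Matrix.of (T k) - Matrix.of (T k) * Phi0) i j

/-- The components of `dη` in terms of those of the intrinsic torsion. -/
def modelDη (T : Tensor3) (i j : Fin 5) : ℝ := T i 4 j - T j 4 i

/-- The components of `dΦ` in terms of those of the intrinsic torsion. -/
def modelDΦ (T : Tensor3) (i j k : Fin 5) : ℝ :=
  modelNablaPhi T i j k - modelNablaPhi T j i k + modelNablaPhi T k i j

/-- The components of `γ` in terms of those of the intrinsic torsion. -/
def modelγ (T : Tensor3) (i j : Fin 5) : ℝ := ∑ l, Phi0 l i * modelDΦ T 4 l j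

/-- The components of the Nijenhuis tensor in terms of those of the intrinsic torsion. -/
def modelN (T : Tensor3) (i j k : Fin 5) : ℝ :=
  ∑ l, (Phi0 l j * modelNablaPhi T l i k - Phi0 l k * modelNablaPhi T l i j
    - Phi0 l i * modelNablaPhi T k l j + Phi0 l i * modelNablaPhi T j l k)
    + eta0 i * modelDη T j k

/-- The tensor `η(X) α(Y, Z) + η(Y) β(Z, X) + η(Z) β(X, Y)`. -/
def etaTensor (α β : Matrix (Fin 5) (Fin 5) ℝ) : Tensor3 := fun k i j ↦
  eta0 k * α i j + eta0 i * β j k + eta0 j * β k i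

theorem sgn_swap (i j : Fin 5) : sgn i j = -sgn j i := by
  revert i j; decide

theorem eps_swap (i j k l m : Fin 5) : eps i j k l m = -eps j i k l m := by
  simp only [eps, sgn_swap i j]
  ring

theorem hodge_apply_of_skew {β : Matrix (Fin 5) (Fin 5) ℝ} (hβ : β.transpose = -β)
    (k l m : Fin 5) :
    hodge β k l m = eps 0 1 k l m * β 0 1 + eps 0 2 k l m * β 0 2 + eps 0 3 k l m * β 0 3
      + eps 0 4 k l m * β 0 4 + eps 1 2 k l m * β 1 2 + eps 1 3 k l m * β 1 3
      + eps 1 4 k l m * β 1 4 + eps 2 3 k l m * β 2 3 + eps 2 4 k l m * β 2 4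
      + eps 3 4 k l m * β 3 4 := by
  have h (i j) : β i j = -β j i := congr($hβ j i)
  have h0 (i) : β i i = 0 := by linarith [h i i]
  simp only [hodge, LinearMap.coe_mk, AddHom.coe_mk, Fin.sum_univ_five]
  rw [eps_swap 1 0, eps_swap 2 0, eps_swap 3 0, eps_swap 4 0, eps_swap 2 1, eps_swap 3 1,
    eps_swap 4 1, eps_swap 3 2, eps_swap 4 2, eps_swap 4 3, h 1 0, h 2 0, h 3 0, h 4 0, h 2 1,
    h 3 1, h 4 1, h 3 2, h 4 2, h 4 3, h0, h0, h0, h0, h0]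
  push_cast
  ring

/-- Integral components of `e₁ ∧ e₃ - e₂ ∧ e₄`. -/
def intBlock₁ : Matrix (Fin 5) (Fin 5) ℤ :=
  !![0, 0, 1, 0, 0; 0, 0, 0, -1, 0; -1, 0, 0, 0, 0; 0, 1, 0, 0, 0; 0, 0, 0, 0, 0]

/-- Integral components of `e₁ ∧ e₄ + e₂ ∧ e₃`. -/
def intBlock₂ : Matrix (Fin 5) (Fin 5) ℤ :=
  !![0, 0, 0, 1, 0; 0, 0, 1, 0, 0; 0, -1, 0, 0, 0; -1, 0, 0, 0, 0; 0, 0, 0, 0, 0]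

/-- Integral components of `Φ`. -/
def intPhi : Matrix (Fin 5) (Fin 5) ℤ :=
  !![0, 1, 0, 0, 0; -1, 0, 0, 0, 0; 0, 0, 0, 1, 0; 0, 0, -1, 0, 0; 0, 0, 0, 0, 0]

theorem perpBlock_zero_apply (r s : ℝ) (i j : Fin 5) :
    perpBlock r s 0 i j = r * intBlock₁ i j + s * intBlock₂ i j := by
  fin_cases i <;> fin_cases j <;> simp [perpBlock, intBlock₁, intBlock₂]

theorem Phi0_apply (i j : Fin 5) : Phi0 i j = intPhi i j := by
  fin_cases i <;> fin_cases j <;> simp [Phi0, intPhi]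

theorem eta0_apply (i : Fin 5) : eta0 i = ((if i = 4 then 1 else 0 : ℤ) : ℝ) := by
  fin_cases i <;> simp [eta0]

theorem perpBlock_zero_transpose (r s : ℝ) : (perpBlock r s 0).transpose = -perpBlock r s 0 := by
  ext i j
  fin_cases i <;> fin_cases j <;> simp [perpBlock]

theorem hodge_perpBlock (r s : ℝ) : hodge (perpBlock r s 0) = etaWedge (perpBlock r s 0) := by
  ext k l m
  have h₁ : ∀ k l m : Fin 5, eps 0 2 k l m - eps 1 3 k l m = (if k = 4 then 1 else 0) * intBlock₁ l m
      + (if l = 4 then 1 else 0) * intBlock₁ m k + (if m = 4 then 1 else 0) * intBlock₁ k l := by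
    decide
  have h₂ : ∀ k l m : Fin 5, eps 0 3 k l m + eps 1 2 k l m = (if k = 4 then 1 else 0) * intBlock₂ l m
      + (if l = 4 then 1 else 0) * intBlock₂ m k + (if m = 4 then 1 else 0) * intBlock₂ k l := by
    decide
  have g₁ := congrArg (Int.cast : ℤ → ℝ) (h₁ k l m)
  have g₂ := congrArg (Int.cast : ℤ → ℝ) (h₂ k l m)
  simp only [Int.cast_sub, Int.cast_add, Int.cast_mul, ← eta0_apply] at g₁ g₂
  rw [hodge_apply_of_skew (perpBlock_zero_transpose r s)]
  simp only [etaWedge, perpBlock_zero_apply r s l m, perpBlock_zero_apply r s m k,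
    perpBlock_zero_apply r s k l]
  simp [perpBlock]
  linear_combination r * g₁ + s * g₂

set_option maxRecDepth 10000 in
theorem PhiWedge_perpBlock (r s : ℝ) (i j k l : Fin 5) :
    PhiWedge (perpBlock r s 0) i j k l = 0 := by
  have h₁ : ∀ i j k l : Fin 5, intPhi i j * intBlock₁ k l - intPhi i k * intBlock₁ j l
      + intPhi i l * intBlock₁ j k + intPhi j k * intBlock₁ i l - intPhi j l * intBlock₁ i k
      + intPhi k l * intBlock₁ i j = 0 := by
    decide
  have h₂ : ∀ i j k l : Fin 5, intPhi i j * intBlock₂ k l - intPhi i k * intBlock₂ j l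
      + intPhi i l * intBlock₂ j k + intPhi j k * intBlock₂ i l - intPhi j l * intBlock₂ i k
      + intPhi k l * intBlock₂ i j = 0 := by
    decide
  have g₁ := congrArg (Int.cast : ℤ → ℝ) (h₁ i j k l)
  have g₂ := congrArg (Int.cast : ℤ → ℝ) (h₂ i j k l)
  push_cast at g₁ g₂
  simp only [PhiWedge, Phi0_apply, perpBlock_zero_apply]
  linear_combination r * g₁ + s * g₂

theorem mem_Lambda22_iff {β : Matrix (Fin 5) (Fin 5) ℝ} :
    β ∈ Lambda22 ↔ ∃ r s, β = perpBlock r s 0 := by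
  constructor
  · rintro ⟨h1, h2, h3⟩
    have h (i j) : β i j = -β j i := congr($h1 j i)
    have h0 (i) : β i i = 0 := by linarith [h i i]
    have k1 := h2 0 1 2 3
    have hodge_eq (k l m) : hodge β k l m = etaWedge β k l m := congr($h3 k l m)
    simp only [hodge_apply_of_skew h1] at hodge_eq
    have k2 := hodge_eq 0 1 4
    have k3 := hodge_eq 0 2 4
    have k4 := hodge_eq 0 3 4
    have k5 := hodge_eq 0 1 2
    have k6 := hodge_eq 0 1 3
    have k7 := hodge_eq 0 2 3
    have k8 := hodge_eq 1 2 3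
    simp [PhiWedge, Phi0] at k1
    simp [etaWedge, eta0, eps, sgn] at k2 k3 k4 k5 k6 k7 k8
    refine ⟨β 0 2, β 0 3, ?_⟩
    ext i j
    fin_cases i <;> fin_cases j <;> simp [perpBlock, h0] <;>
      linarith [h 0 1, h 0 2, h 0 3, h 0 4, h 1 2, h 1 3, h 1 4, h 2 3, h 2 4, h 3 4]
  · rintro ⟨r, s, rfl⟩
    exact ⟨perpBlock_zero_transpose r s, PhiWedge_perpBlock r s, hodge_perpBlock r s⟩

end ModelComponents

section ModelClasses

theorem perpBlock_add (p q p' q' : ℝ) :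
    perpBlock p q 0 + perpBlock p' q' 0 = perpBlock (p + p') (q + q') 0 := by
  ext i j
  simp only [Matrix.add_apply, perpBlock_zero_apply]
  ring

theorem smul_perpBlock (c p q : ℝ) : c • perpBlock p q 0 = perpBlock (c * p) (c * q) 0 := by
  ext i j
  simp only [Matrix.smul_apply, smul_eq_mul, perpBlock_zero_apply]
  ring

theorem etaTensor_add (α β α' β' : Matrix (Fin 5) (Fin 5) ℝ) :
    etaTensor α β + etaTensor α' β' = etaTensor (α + α') (β + β') := by
  ext k i j
  simp only [etaTensor, Pi.add_apply, Matrix.add_apply]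
  ring

theorem theta_perpBlock (r s : ℝ) :
    theta (perpBlock r s 0) = etaTensor (perpBlock r s 0) (perpBlock r s 0) :=
  hodge_perpBlock r s

theorem vartheta_perpBlock (r s : ℝ) :
    vartheta (perpBlock r s 0) = etaTensor (perpBlock (2 * r) (2 * s) 0) (perpBlock (-r) (-s) 0) := by
  ext k i j
  simp only [vartheta, LinearMap.coe_mk, AddHom.coe_mk, hodge_perpBlock, etaWedge, etaTensor,
    perpBlock_zero_apply]
  ring

theorem mem_W4_iff {T : Tensor3} :
    T ∈ W4 ↔ ∃ r s, T = etaTensor (perpBlock r s 0) (perpBlock r s 0) := by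
  constructor
  · rintro ⟨β, hβ, rfl⟩
    obtain ⟨r, s, rfl⟩ := mem_Lambda22_iff.1 hβ
    exact ⟨r, s, theta_perpBlock r s⟩
  · rintro ⟨r, s, rfl⟩
    exact ⟨_, mem_Lambda22_iff.2 ⟨r, s, rfl⟩, theta_perpBlock r s⟩

theorem mem_W7_iff {T : Tensor3} :
    T ∈ W7 ↔ ∃ r s, T = etaTensor (perpBlock (2 * r) (2 * s) 0) (perpBlock (-r) (-s) 0) := by
  constructor
  · rintro ⟨β, hβ, rfl⟩
    obtain ⟨r, s, rfl⟩ := mem_Lambda22_iff.1 hβ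
    exact ⟨r, s, vartheta_perpBlock r s⟩
  · rintro ⟨r, s, rfl⟩
    exact ⟨_, mem_Lambda22_iff.2 ⟨r, s, rfl⟩, vartheta_perpBlock r s⟩

theorem mem_W4_sup_W7_iff {T : Tensor3} :
    T ∈ W4 ⊔ W7 ↔ ∃ r s c d, T = etaTensor (perpBlock r s 0) (perpBlock c d 0) := by
  rw [Submodule.mem_sup]
  constructor
  · rintro ⟨T₁, h₁, T₂, h₂, rfl⟩
    obtain ⟨r, s, rfl⟩ := mem_W4_iff.1 h₁
    obtain ⟨c, d, rfl⟩ := mem_W7_iff.1 h₂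
    exact ⟨_, _, _, _, by rw [etaTensor_add, perpBlock_add, perpBlock_add]⟩
  · rintro ⟨r, s, c, d, rfl⟩
    refine ⟨_, mem_W4_iff.2 ⟨(r + 2 * c) / 3, (s + 2 * d) / 3, rfl⟩, _,
      mem_W7_iff.2 ⟨(r - c) / 3, (s - d) / 3, rfl⟩, ?_⟩
    rw [etaTensor_add, perpBlock_add, perpBlock_add]
    congr 2 <;> ring

theorem sum_Phi0_mul (f : Fin 5 → ℝ) (j : Fin 5) :
    ∑ l, Phi0 l j * f l = ![-f 1, f 0, -f 3, f 2, 0] j := by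
  fin_cases j <;> simp [Phi0, Fin.sum_univ_five]

theorem modelNablaPhi_etaTensor (r s c d : ℝ) :
    modelNablaPhi (etaTensor (perpBlock r s 0) (perpBlock c d 0))
      = etaTensor (perpBlock (2 * s) (-2 * r) 0) (perpBlock d (-c) 0) := by
  ext k i j
  simp only [modelNablaPhi, Matrix.sub_apply, Phi0_mul_apply, mul_Phi0_apply, Matrix.of_apply]
  fin_cases k <;> fin_cases i <;> fin_cases j <;> simp [etaTensor, perpBlock, eta0] <;> ring

theorem modelDη_etaTensor (r s c d : ℝ) (i j : Fin 5) :
    modelDη (etaTensor (perpBlock r s 0) (perpBlock c d 0)) i j = -2 * perpBlock c d 0 i j := by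
  fin_cases i <;> fin_cases j <;> simp [modelDη, etaTensor, perpBlock, eta0] <;> ring

theorem perpBlock_zero_skew (c d : ℝ) (i j : Fin 5) : perpBlock c d 0 i j = -perpBlock c d 0 j i :=
  congr($(perpBlock_zero_transpose c d) j i)

theorem modelDΦ_etaTensor (r s c d : ℝ) (i j k : Fin 5) :
    modelDΦ (etaTensor (perpBlock r s 0) (perpBlock c d 0)) i j k
      = etaTensor (perpBlock (2 * (s + d)) (-2 * (r + c)) 0)
        (perpBlock (2 * (s + d)) (-2 * (r + c)) 0) i j k := by
  have h := perpBlock_zero_skew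
  have e : perpBlock (2 * (s + d)) (-2 * (r + c)) 0
      = perpBlock (2 * s) (-2 * r) 0 + (2 : ℝ) • perpBlock d (-c) 0 := by
    rw [smul_perpBlock, perpBlock_add]
    congr 1 <;> ring
  simp only [modelDΦ, modelNablaPhi_etaTensor, e, etaTensor, Matrix.add_apply, Matrix.smul_apply,
    smul_eq_mul]
  rw [h _ _ k i, h _ _ k j, h _ _ j i, h _ _ k i]
  ring

theorem sum_Phi0_mul_perpBlock_left (c d : ℝ) (j k : Fin 5) :
    ∑ l, Phi0 l j * perpBlock c d 0 l k = perpBlock (-d) c 0 j k := by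
  rw [sum_Phi0_mul]
  fin_cases j <;> fin_cases k <;> simp [perpBlock]

theorem sum_Phi0_mul_perpBlock_right (c d : ℝ) (j k : Fin 5) :
    ∑ l, Phi0 l j * perpBlock c d 0 k l = perpBlock (-d) c 0 k j := by
  rw [sum_Phi0_mul]
  fin_cases j <;> fin_cases k <;> simp [perpBlock]

theorem sum_Phi0_mul_eta0 (j : Fin 5) : ∑ l, Phi0 l j * eta0 l = 0 := by
  rw [sum_Phi0_mul]
  fin_cases j <;> simp [eta0]

theorem sum_Phi0_mul_etaTensor_first (r s c d : ℝ) (i j k : Fin 5) :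
    ∑ l, Phi0 l j * etaTensor (perpBlock r s 0) (perpBlock c d 0) l i k
      = eta0 i * perpBlock (-d) c 0 k j + eta0 k * perpBlock (-d) c 0 j i := by
  rw [← sum_Phi0_mul_perpBlock_left c d j i, ← sum_Phi0_mul_perpBlock_right c d j k,
    Finset.mul_sum, Finset.mul_sum, ← Finset.sum_add_distrib, ← sub_eq_zero,
    ← Finset.sum_sub_distrib, ← zero_mul (perpBlock r s 0 i k), ← sum_Phi0_mul_eta0 j,
    Finset.sum_mul]
  refine Finset.sum_congr rfl fun l _ ↦ ?_
  simp only [etaTensor]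
  ring

theorem sum_Phi0_mul_etaTensor_second (r s c d : ℝ) (i j k : Fin 5) :
    ∑ l, Phi0 l i * etaTensor (perpBlock r s 0) (perpBlock c d 0) k l j
      = eta0 k * perpBlock (-s) r 0 i j + eta0 j * perpBlock (-d) c 0 k i := by
  rw [← sum_Phi0_mul_perpBlock_left r s i j, ← sum_Phi0_mul_perpBlock_right c d i k,
    Finset.mul_sum, Finset.mul_sum, ← Finset.sum_add_distrib, ← sub_eq_zero,
    ← Finset.sum_sub_distrib, ← zero_mul (perpBlock c d 0 j k), ← sum_Phi0_mul_eta0 i,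
    Finset.sum_mul]
  refine Finset.sum_congr rfl fun l _ ↦ ?_
  simp only [etaTensor]
  ring

theorem modelγ_etaTensor (r s c d : ℝ) (i j : Fin 5) :
    modelγ (etaTensor (perpBlock r s 0) (perpBlock c d 0)) i j
      = 2 * perpBlock (r + c) (s + d) 0 i j := by
  have h (c d : ℝ) : perpBlock c d 0 4 i = 0 := by
    fin_cases i <;> simp [perpBlock]
  have e : perpBlock (- (-2 * (r + c))) (2 * (s + d)) 0 = (2 : ℝ) • perpBlock (r + c) (s + d) 0 := by
    rw [smul_perpBlock, neg_mul, neg_neg]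
  simp only [modelγ, modelDΦ_etaTensor, sum_Phi0_mul_etaTensor_second, h, e, Matrix.smul_apply]
  simp [eta0]

theorem modelN_etaTensor (r s c d : ℝ) (i j k : Fin 5) :
    modelN (etaTensor (perpBlock r s 0) (perpBlock c d 0)) i j k
      = -4 * eta0 i * perpBlock c d 0 j k + 2 * eta0 j * perpBlock (r + c) (s + d) 0 i k
        - 2 * eta0 k * perpBlock (r + c) (s + d) 0 i j := by
  have h := perpBlock_zero_skew c d
  have e : perpBlock (2 * r) (2 * s) 0 = (2 : ℝ) • perpBlock r s 0 := by
    rw [smul_perpBlock]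
  simp only [modelN, Finset.sum_add_distrib, Finset.sum_sub_distrib, modelNablaPhi_etaTensor,
    modelDη_etaTensor, sum_Phi0_mul_etaTensor_first, sum_Phi0_mul_etaTensor_second,
    ← perpBlock_add, Matrix.add_apply, neg_mul, neg_neg, e, Matrix.smul_apply, smul_eq_mul]
  rw [h k j, h j i, h k i]
  ring

end ModelClasses

section ModelClasses

variable {T : Tensor3} {p q : Fin 5 → ℝ} {a : Fin 5 → Fin 4 → ℝ}

theorem modelNablaPhi_perpBlock (hT : ∀ k, T k = perpBlock (p k) (q k) (a k)) (k : Fin 5) :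
    modelNablaPhi T k = !![0, 0, 2 * q k, -2 * p k, a k 1; 0, 0, -2 * p k, -2 * q k, -a k 0;
      -2 * q k, 2 * p k, 0, 0, a k 3; 2 * p k, 2 * q k, 0, 0, -a k 2;
      -a k 1, a k 0, -a k 3, a k 2, 0] := by
  ext i j
  have e : Matrix.of (T k) = perpBlock (p k) (q k) (a k) := hT k
  simp only [modelNablaPhi, e, Matrix.sub_apply, Phi0_mul_apply, mul_Phi0_apply]
  fin_cases i <;> fin_cases j <;> simp [perpBlock] <;> ring

theorem horizontal_eq_zero_of_model (hT : ∀ k, T k = perpBlock (p k) (q k) (a k))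
    (hN : ∀ i j k : Fin 5, i ≠ 4 → j ≠ 4 → k ≠ 4 → modelN T i j k = 0)
    (hΦ : ∀ i j k : Fin 5, i ≠ 4 → j ≠ 4 → k ≠ 4 → modelDΦ T i j k = 0) (k : Fin 5) (hk : k ≠ 4) :
    p k = 0 ∧ q k = 0 := by
  simp only [modelN, modelDΦ, Finset.sum_add_distrib, Finset.sum_sub_distrib, sum_Phi0_mul,
    modelNablaPhi_perpBlock hT] at hN hΦ
  have n1 := hN 0 0 2 (by decide) (by decide) (by decide)
  have n2 := hN 0 0 3 (by decide) (by decide) (by decide)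
  have n3 := hN 2 0 2 (by decide) (by decide) (by decide)
  have n4 := hN 2 0 3 (by decide) (by decide) (by decide)
  have f1 := hΦ 0 1 2 (by decide) (by decide) (by decide)
  have f2 := hΦ 0 1 3 (by decide) (by decide) (by decide)
  have f3 := hΦ 0 2 3 (by decide) (by decide) (by decide)
  have f4 := hΦ 1 2 3 (by decide) (by decide) (by decide)
  simp [eta0] at n1 n2 n3 n4 f1 f2 f3 f4
  fin_cases k <;> first | exact absurd rfl hk | (constructor <;> simp <;> linarith)

theorem vertical_eq_of_model (hT : ∀ k, T k = perpBlock (p k) (q k) (a k))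
    (hK : ∀ i j, T i 4 j + T j 4 i = 0)
    (hξ : ∀ i j, modelN T 4 i j = 2 * modelDη T i j) :
    a 0 = ![0, 0, -a 2 0, -a 3 0] ∧ a 1 = ![0, 0, -a 3 0, a 2 0] ∧
      a 2 = ![a 2 0, a 3 0, 0, 0] ∧ a 3 = ![a 3 0, -a 2 0, 0, 0] ∧ a 4 = 0 := by
  simp only [modelN, modelDη, Finset.sum_add_distrib, Finset.sum_sub_distrib, sum_Phi0_mul,
    modelNablaPhi_perpBlock hT] at hξ
  simp only [hT] at hK hξ
  have x1 := hξ 0 1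
  have x2 := hξ 0 2
  have x3 := hξ 0 3
  have x4 := hξ 1 2
  have x5 := hξ 1 3
  have x6 := hξ 2 3
  simp [perpBlock, eta0] at x1 x2 x3 x4 x5 x6
  have k1 := hK 0 0
  have k2 := hK 0 1
  have k3 := hK 0 2
  have k4 := hK 0 3
  have k5 := hK 0 4
  have k6 := hK 1 1
  have k7 := hK 1 2
  have k8 := hK 1 3
  have k9 := hK 1 4
  have k10 := hK 2 2
  have k11 := hK 2 3
  have k12 := hK 2 4
  have k13 := hK 3 3
  have k14 := hK 3 4
  simp [perpBlock] at k1 k2 k3 k4 k5 k6 k7 k8 k9 k10 k11 k12 k13 k14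
  refine ⟨?_, ?_, ?_, ?_, ?_⟩ <;> ext i <;> fin_cases i <;> simp <;> linarith

/-- A tensor with values in `u(2)^⊥` satisfying the component form of the generalized
quasi-Sasaki conditions and `N(ξ, X, Y) = 2 dη(X, Y)` belongs to `W₄ ⊕ W₇`. -/
theorem mem_W4_sup_W7_of_model (hT : ∀ k, T k = perpBlock (p k) (q k) (a k))
    (hN : ∀ i j k : Fin 5, i ≠ 4 → j ≠ 4 → k ≠ 4 → modelN T i j k = 0)
    (hΦ : ∀ i j k : Fin 5, i ≠ 4 → j ≠ 4 → k ≠ 4 → modelDΦ T i j k = 0)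
    (hK : ∀ i j, T i 4 j + T j 4 i = 0)
    (hξ : ∀ i j, modelN T 4 i j = 2 * modelDη T i j) : T ∈ W4 ⊔ W7 := by
  have h := horizontal_eq_zero_of_model hT hN hΦ
  obtain ⟨p0, q0⟩ := h 0 (by decide)
  obtain ⟨p1, q1⟩ := h 1 (by decide)
  obtain ⟨p2, q2⟩ := h 2 (by decide)
  obtain ⟨p3, q3⟩ := h 3 (by decide)
  obtain ⟨a0, a1, a2, a3, a4⟩ := vertical_eq_of_model hT hK hξ
  generalize a 2 0 = c at a0 a1 a2 a3
  generalize a 3 0 = d at a0 a1 a2 a3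
  rw [mem_W4_sup_W7_iff]
  refine ⟨p 4, q 4, -c, -d, ?_⟩
  ext k i j
  rw [hT]
  fin_cases k <;> simp only [Fin.zero_eta, Fin.mk_one, Fin.reduceFinMk, p0, q0, p1, q1, p2, q2, p3,
    q3, a0, a1, a2, a3, a4] <;> fin_cases i <;> fin_cases j <;> simp [perpBlock, etaTensor, eta0]

end ModelClasses

section FrameComponents

variable {E : Type*} [NormedAddCommGroup E] [NormedSpace ℝ E] [FiniteDimensional ℝ E]
  {H : Type*} [TopologicalSpace H] {I : ModelWithCorners ℝ E H}
  {M : Type*} [TopologicalSpace M] [ChartedSpace H M] [IsManifold I ∞ M]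

namespace AlmostContactMetricStructure

section Linearity

variable (S : AlmostContactMetricStructure I M) (x : M)

theorem isLinearMap_nablaPhi_first (v w : TangentSpace I x) :
    IsLinearMap ℝ (S.nablaPhi x · v w) where
  map_add u v := by simp [nablaPhi]
  map_smul c v := by simp [nablaPhi]

theorem isLinearMap_nablaPhi_second (u w : TangentSpace I x) :
    IsLinearMap ℝ (S.nablaPhi x u · w) where
  map_add v v' := by
    simp only [nablaPhi]
    rw [ContinuousLinearMap.map_add]
    rfl
  map_smul c v := by
    simp only [nablaPhi]
    rw [ContinuousLinearMap.map_smul]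
    rfl

theorem isLinearMap_nablaPhi_third (u v : TangentSpace I x) :
    IsLinearMap ℝ (S.nablaPhi x u v ·) where
  map_add w w' := by
    simp only [nablaPhi]
    rw [ContinuousLinearMap.map_add]
    rfl
  map_smul c w := by
    simp only [nablaPhi]
    rw [ContinuousLinearMap.map_smul]
    rfl

theorem isLinearMap_dη_left (w : TangentSpace I x) : IsLinearMap ℝ (S.dη x · w) where
  map_add u v := by simp [dη, nablaEta]; ring
  map_smul c v := by simp [dη, nablaEta]; ring

theorem isLinearMap_dη_right (v : TangentSpace I x) : IsLinearMap ℝ (S.dη x v ·) where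
  map_add u v := by simp [dη, nablaEta]; ring
  map_smul c v := by simp [dη, nablaEta]; ring

theorem isLinearMap_dΦ_first (v w : TangentSpace I x) : IsLinearMap ℝ (S.dΦ x · v w) where
  map_add _ _ := by
    simp only [dΦ, (S.isLinearMap_nablaPhi_first x _ _).map_add, (S.isLinearMap_nablaPhi_second x _ _).map_add]
    ring
  map_smul _ _ := by
    simp only [dΦ, (S.isLinearMap_nablaPhi_first x _ _).map_smul, (S.isLinearMap_nablaPhi_second x _ _).map_smul, smul_eq_mul]
    ring

theorem isLinearMap_dΦ_second (u w : TangentSpace I x) : IsLinearMap ℝ (S.dΦ x u · w) where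
  map_add _ _ := by
    simp only [dΦ, (S.isLinearMap_nablaPhi_first x _ _).map_add, (S.isLinearMap_nablaPhi_second x _ _).map_add, (S.isLinearMap_nablaPhi_third x _ _).map_add]
    ring
  map_smul _ _ := by
    simp only [dΦ, (S.isLinearMap_nablaPhi_first x _ _).map_smul, (S.isLinearMap_nablaPhi_second x _ _).map_smul, (S.isLinearMap_nablaPhi_third x _ _).map_smul, smul_eq_mul]
    ring

theorem isLinearMap_dΦ_third (u v : TangentSpace I x) : IsLinearMap ℝ (S.dΦ x u v ·) where
  map_add _ _ := by
    simp only [dΦ, (S.isLinearMap_nablaPhi_first x _ _).map_add, (S.isLinearMap_nablaPhi_third x _ _).map_add]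
    ring
  map_smul _ _ := by
    simp only [dΦ, (S.isLinearMap_nablaPhi_first x _ _).map_smul, (S.isLinearMap_nablaPhi_third x _ _).map_smul, smul_eq_mul]
    ring

theorem isLinearMap_γ_left (w : TangentSpace I x) : IsLinearMap ℝ (S.γ x · w) where
  map_add _ _ := by simp only [γ, map_add, (S.isLinearMap_dΦ_second x _ _).map_add]
  map_smul _ _ := by simp only [γ, map_smul, (S.isLinearMap_dΦ_second x _ _).map_smul]

theorem isLinearMap_γ_right (v : TangentSpace I x) : IsLinearMap ℝ (S.γ x v ·) :=
  S.isLinearMap_dΦ_third x _ _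

theorem isLinearMap_N_first (v w : TangentSpace I x) : IsLinearMap ℝ (S.N x · v w) where
  map_add u v := by simp [N]; ring
  map_smul c v := by simp [N]; ring

theorem isLinearMap_N_second (u w : TangentSpace I x) : IsLinearMap ℝ (S.N x u · w) where
  map_add u v := by simp [N, (S.isLinearMap_dη_left x w).map_add]; ring
  map_smul c v := by simp [N, (S.isLinearMap_dη_left x w).map_smul]; ring

theorem isLinearMap_N_third (u v : TangentSpace I x) : IsLinearMap ℝ (S.N x u v ·) where
  map_add w w' := by simp [N, (S.isLinearMap_dη_right x v).map_add]; ring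
  map_smul c w := by simp [N, (S.isLinearMap_dη_right x v).map_smul]; ring

theorem isLinearMap_nablaEta_left (w : TangentSpace I x) : IsLinearMap ℝ (S.nablaEta x · w) where
  map_add u v := by simp [nablaEta]
  map_smul c v := by simp [nablaEta]

theorem isLinearMap_nablaEta_right (v : TangentSpace I x) : IsLinearMap ℝ (S.nablaEta x v ·) where
  map_add u v := by simp [nablaEta]
  map_smul c v := by simp [nablaEta]

end Linearity

variable {S : AlmostContactMetricStructure I M} {x : M} (F : S.AdaptedFrame x)

namespace AdaptedFrame

/-- The components of a tangent vector at `x` with respect to the adapted frame. -/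
def coord (u : TangentSpace I x) (i : Fin 5) : ℝ := S.g.inner x (F.e i x) u

theorem coord_four (u : TangentSpace I x) : F.coord u 4 = S.η x u := by
  rw [coord, F.e_four, η]

theorem apply_eq_sum (hE : Module.finrank ℝ E = 5) {f : TangentSpace I x → ℝ}
    (hf : IsLinearMap ℝ f) (u : TangentSpace I x) : f u = ∑ i, F.coord u i * f (F.e i x) := by
  conv_lhs => rw [← sum_inner_smul hE S.g F.inner_e u]
  have := map_sum (hf.mk' f) (fun i ↦ S.g.inner x (F.e i x) u • F.e i x) Finset.univ
  simpa only [IsLinearMap.mk'_apply, hf.map_smul, coord, smul_eq_mul] using this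

theorem apply₂_eq_sum (hE : Module.finrank ℝ E = 5) {f : TangentSpace I x → TangentSpace I x → ℝ}
    (h₁ : ∀ v, IsLinearMap ℝ (f · v)) (h₂ : ∀ u, IsLinearMap ℝ (f u ·))
    (u v : TangentSpace I x) :
    f u v = ∑ i, ∑ j, F.coord u i * F.coord v j * f (F.e i x) (F.e j x) := by
  rw [F.apply_eq_sum hE (h₁ v)]
  simp only [fun i ↦ F.apply_eq_sum hE (h₂ (F.e i x)) v, Finset.mul_sum, mul_assoc]

theorem apply₃_eq_sum (hE : Module.finrank ℝ E = 5)
    {f : TangentSpace I x → TangentSpace I x → TangentSpace I x → ℝ}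
    (h₁ : ∀ v w, IsLinearMap ℝ (f · v w)) (h₂ : ∀ u w, IsLinearMap ℝ (f u · w))
    (h₃ : ∀ u v, IsLinearMap ℝ (f u v ·)) (u v w : TangentSpace I x) :
    f u v w = ∑ i, ∑ j, ∑ k, F.coord u i * F.coord v j * F.coord w k *
      f (F.e i x) (F.e j x) (F.e k x) := by
  rw [F.apply_eq_sum hE (h₁ v w)]
  simp only [fun i ↦ F.apply₂_eq_sum hE (h₂ (F.e i x)) (h₃ (F.e i x)) v w, Finset.mul_sum,
    mul_assoc]

/-- A trilinear form vanishing on horizontal frame vectors vanishes on horizontal vectors. -/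
theorem apply₃_eq_zero (hE : Module.finrank ℝ E = 5)
    {f : TangentSpace I x → TangentSpace I x → TangentSpace I x → ℝ}
    (h₁ : ∀ v w, IsLinearMap ℝ (f · v w)) (h₂ : ∀ u w, IsLinearMap ℝ (f u · w))
    (h₃ : ∀ u v, IsLinearMap ℝ (f u v ·))
    (h : ∀ i j k : Fin 5, i ≠ 4 → j ≠ 4 → k ≠ 4 → f (F.e i x) (F.e j x) (F.e k x) = 0)
    {u v w : TangentSpace I x} (hu : S.η x u = 0) (hv : S.η x v = 0) (hw : S.η x w = 0) :
    f u v w = 0 := by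
  rw [F.apply₃_eq_sum hE h₁ h₂ h₃]
  refine Finset.sum_eq_zero fun i _ ↦ Finset.sum_eq_zero fun j _ ↦ Finset.sum_eq_zero fun k _ ↦ ?_
  rw [← F.coord_four] at hu hv hw
  by_cases hi : i = 4
  · simp [hi, hu]
  by_cases hj : j = 4
  · simp [hj, hv]
  by_cases hk : k = 4
  · simp [hk, hw]
  rw [h i j k hi hj hk, mul_zero]

theorem coord_φ_e (hE : Module.finrank ℝ E = 5) (j l : Fin 5) :
    F.coord (S.φ x (F.e j x)) l = Phi0 l j := by
  simp [coord, F.φ_e hE, F.inner_e]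

theorem η_e (i : Fin 5) : S.η x (F.e i x) = eta0 i := F.eta x F.mem i

end AdaptedFrame

theorem intrinsicTorsion_eq_perpBlock : ∃ (p q : Fin 5 → ℝ) (a : Fin 5 → Fin 4 → ℝ),
    ∀ k, intrinsicTorsion F k = perpBlock (p k) (q k) (a k) :=
  ⟨_, _, _, fun k ↦ prPerp_eq_perpBlock (connectionForm_transpose F (F.e k x))⟩

theorem nablaPhi_φ_first (hE : Module.finrank ℝ E = 5) (j : Fin 5) (v w : TangentSpace I x) :
    S.nablaPhi x (S.φ x (F.e j x)) v w = ∑ l, Phi0 l j * S.nablaPhi x (F.e l x) v w := by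
  rw [F.apply_eq_sum hE (S.isLinearMap_nablaPhi_first x v w)]
  simp only [F.coord_φ_e hE]

theorem nablaPhi_φ_second (hE : Module.finrank ℝ E = 5) (j : Fin 5) (u w : TangentSpace I x) :
    S.nablaPhi x u (S.φ x (F.e j x)) w = ∑ l, Phi0 l j * S.nablaPhi x u (F.e l x) w := by
  rw [F.apply_eq_sum hE (S.isLinearMap_nablaPhi_second x u w)]
  simp only [F.coord_φ_e hE]

theorem nablaEta_frame_eq (i j : Fin 5) :
    S.nablaEta x (F.e i x) (F.e j x) = intrinsicTorsion F i 4 j := by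
  rw [nablaEta_frame, intrinsicTorsion, prPerp_four (connectionForm_transpose F _)]

theorem dη_frame (i j : Fin 5) :
    S.dη x (F.e i x) (F.e j x) = modelDη (intrinsicTorsion F) i j := by
  simp only [dη, nablaEta_frame_eq, modelDη]

theorem nablaPhi_frame_eq (hE : Module.finrank ℝ E = 5) (k i j : Fin 5) :
    S.nablaPhi x (F.e k x) (F.e i x) (F.e j x) = modelNablaPhi (intrinsicTorsion F) k i j := by
  rw [nablaPhi_frame F hE, ← commutator_prPerp (connectionForm_transpose F _)]
  rfl

theorem dΦ_frame (hE : Module.finrank ℝ E = 5) (i j k : Fin 5) :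
    S.dΦ x (F.e i x) (F.e j x) (F.e k x) = modelDΦ (intrinsicTorsion F) i j k := by
  simp only [dΦ, nablaPhi_frame_eq F hE, modelDΦ]

theorem γ_frame (hE : Module.finrank ℝ E = 5) (i j : Fin 5) :
    S.γ x (F.e i x) (F.e j x) = modelγ (intrinsicTorsion F) i j := by
  rw [γ, F.apply_eq_sum hE (S.isLinearMap_dΦ_second x _ _)]
  simp only [modelγ, ← F.e_four, dΦ_frame F hE, F.coord_φ_e hE]

theorem N_frame (hE : Module.finrank ℝ E = 5) (i j k : Fin 5) :
    S.N x (F.e i x) (F.e j x) (F.e k x) = modelN (intrinsicTorsion F) i j k := by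
  rw [N_eq]
  simp only [nablaPhi_φ_first F hE, nablaPhi_φ_second F hE, nablaPhi_frame_eq F hE, dη_frame, modelN,
    F.η_e, Finset.sum_add_distrib, Finset.sum_sub_distrib]

end AlmostContactMetricStructure
end FrameComponents

section FrameExistence

variable {E : Type*} [NormedAddCommGroup E] [NormedSpace ℝ E] [FiniteDimensional ℝ E]
  {H : Type*} [TopologicalSpace H] {I : ModelWithCorners ℝ E H}
  {M : Type*} [TopologicalSpace M] [ChartedSpace H M] [IsManifold I ∞ M]

theorem Metric.contMDiffOn (g : Metric I M) {X Y : Π x : M, TangentSpace I x} {U : Set M}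
    (hX : CMDiff[U] ∞ (T% X)) (hY : CMDiff[U] ∞ (T% Y)) :
    CMDiff[U] ∞ (fun y ↦ g.inner y (X y) (Y y)) := by
  have : ContMDiffOn I (I.prod 𝓘(ℝ)) ∞
      (fun m ↦ TotalSpace.mk' ℝ (E := Bundle.Trivial M ℝ) m (g.inner m (X m) (Y m))) U :=
    ContMDiffOn.clm_bundle_apply₂ (F₁ := E) (F₂ := E) g.contMDiff.contMDiffOn hX hY
  intro x hx
  have h := this x hx
  rw [contMDiffWithinAt_totalSpace] at h
  exact h.2

/-- A smooth vector field which does not vanish at `x` can be normalized near `x`. -/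
theorem exists_normalize (g : Metric I M) {X : Π x : M, TangentSpace I x} {U : Set M} {x : M}
    (hU : IsOpen U) (hxU : x ∈ U) (hX : CMDiff[U] ∞ (T% X)) (hx : X x ≠ 0) :
    ∃ (V : Set M) (c : M → ℝ), IsOpen V ∧ x ∈ V ∧ V ⊆ U ∧ CMDiff[V] ∞ (T% (c • X)) ∧
      ∀ y ∈ V, g.inner y ((c • X) y) ((c • X) y) = 1 := by
  have hg := g.contMDiffOn hX hX
  have hV : IsOpen (U ∩ (fun y ↦ g.inner y (X y) (X y)) ⁻¹' Set.Ioi 0) :=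
    hg.continuousOn.isOpen_inter_preimage hU isOpen_Ioi
  refine ⟨_, fun y ↦ (√(g.inner y (X y) (X y)))⁻¹, hV, ⟨hxU, g.pos x _ hx⟩,
    Set.inter_subset_left, ?_, ?_⟩
  · refine ContMDiffOn.smul_section ?_ (hX.mono Set.inter_subset_left)
    intro y hy
    have h0 : ContDiffAt ℝ ∞ (fun t : ℝ ↦ (√t)⁻¹) (g.inner y (X y) (X y)) :=
      (Real.contDiffAt_sqrt (ne_of_gt hy.2)).inv (Real.sqrt_pos.2 hy.2).ne'
    exact h0.contMDiffAt.comp_contMDiffWithinAt (g := fun t : ℝ ↦ (√t)⁻¹) y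
      ((hg y hy.1).mono Set.inter_subset_left)
  · intro y hy
    have h1 : 0 < g.inner y (X y) (X y) := hy.2
    simp only [Pi.smul_apply', map_smul, smul_apply, smul_eq_mul]
    rw [← mul_assoc, ← mul_inv, Real.mul_self_sqrt h1.le, inv_mul_cancel₀ h1.ne']

theorem exists_orthogonal_ne_zero (g : Metric I M) {n : ℕ} (hn : n < Module.finrank ℝ E) {x : M}
    (f : Fin n → TangentSpace I x) : ∃ v ≠ 0, ∀ i, g.inner x (f i) v = 0 := by
  let L : TangentSpace I x →ₗ[ℝ] (Fin n → ℝ) :=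
    LinearMap.pi fun i ↦ (g.inner x (f i)).toLinearMap
  have hL : ¬ Function.Injective L := fun h ↦ by
    have := LinearMap.finrank_le_finrank_of_injective h
    rw [Module.finrank_fin_fun] at this
    exact absurd (lt_of_lt_of_le hn this) (lt_irrefl _)
  rw [← LinearMap.ker_eq_bot, Submodule.eq_bot_iff] at hL
  push Not at hL
  obtain ⟨v, hv, h0⟩ := hL
  exact ⟨v, h0, fun i ↦ congr($(LinearMap.mem_ker.1 hv) i)⟩

/-- An orthonormal family of fewer than `dim M` smooth vector fields near `x` can be extended by
a smooth unit vector field orthogonal to it. -/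
theorem exists_unit_orthogonal (g : Metric I M) {n : ℕ} (hn : n < Module.finrank ℝ E)
    {U : Set M} {x : M} (hU : IsOpen U) (hxU : x ∈ U) (f : Fin n → Π x : M, TangentSpace I x)
    (hf : ∀ i, CMDiff[U] ∞ (T% (f i)))
    (ho : ∀ y ∈ U, ∀ i j, g.inner y (f i y) (f j y) = if i = j then 1 else 0) :
    ∃ (V : Set M) (X : Π x : M, TangentSpace I x), IsOpen V ∧ x ∈ V ∧ V ⊆ U ∧
      CMDiff[V] ∞ (T% X) ∧ ∀ y ∈ V, g.inner y (X y) (X y) = 1 ∧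
        ∀ i, g.inner y (f i y) (X y) = 0 := by
  obtain ⟨v, hv, hv'⟩ := exists_orthogonal_ne_zero g hn (fun i ↦ f i x)
  obtain ⟨s, hs, hs'⟩ := exists_contMDiffOn_extend (k := ∞) I E v
  obtain ⟨t, ht, hto, hxt⟩ := mem_nhds_iff.1 hs
  have hW : CMDiff[U ∩ t] ∞ (T% (extend E v)) := hs'.mono (Set.inter_subset_right.trans ht)
  have hfW (i : Fin n) : CMDiff[U ∩ t] ∞ (T% (f i)) := (hf i).mono Set.inter_subset_left
  let Y : Π x : M, TangentSpace I x :=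
    extend E v - fun y ↦ ∑ i, ((fun y ↦ g.inner y (f i y) (extend E v y)) • f i) y
  have hY : CMDiff[U ∩ t] ∞ (T% Y) := by
    refine ContMDiffOn.sub_section hW (ContMDiffOn.sum_section fun i _ ↦ ?_)
    exact ContMDiffOn.smul_section (g.contMDiffOn (hfW i) hW) (hfW i)
  have hYx : Y x = v := by simp [Y, hv']
  have hYo (y) (hy : y ∈ U) (i : Fin n) : g.inner y (f i y) (Y y) = 0 := by
    simp [Y, ho y hy]
  obtain ⟨V, c, hV, hxV, hVU, hc, hc'⟩ := exists_normalize g (hU.inter hto) ⟨hxU, hxt⟩ hY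
    (hYx ▸ hv)
  refine ⟨V, c • Y, hV, hxV, hVU.trans Set.inter_subset_left, hc, fun y hy ↦ ⟨hc' y hy, fun i ↦ ?_⟩⟩
  simp [hYo y (hVU hy).1 i]

namespace AlmostContactMetricStructure

variable (S : AlmostContactMetricStructure I M)

theorem contMDiffOn_φ {X : Π x : M, TangentSpace I x} {U : Set M} (hX : CMDiff[U] ∞ (T% X)) :
    CMDiff[U] ∞ (T% (fun y ↦ S.φ y (X y))) :=
  ContMDiffOn.clm_bundle_apply (F₁ := E) (F₂ := E) S.contMDiff_φ.contMDiffOn hX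

theorem inner_φ_self (x : M) (v : TangentSpace I x) : S.g.inner x v (S.φ x v) = 0 := by
  have := S.inner_φ_left x v v
  rw [S.g.symm] at this
  linarith

/-- The frame `(u, -φ(u), v, -φ(v), ξ)`. -/
def frameVectors (x : M) (u v : TangentSpace I x) : Fin 5 → TangentSpace I x :=
  ![u, -S.φ x u, v, -S.φ x v, S.ξ x]

theorem inner_frameVectors {x : M} {u v : TangentSpace I x} (hu : S.g.inner x u u = 1)
    (hv : S.g.inner x v v = 1) (hξu : S.g.inner x (S.ξ x) u = 0)
    (hξv : S.g.inner x (S.ξ x) v = 0) (huv : S.g.inner x u v = 0)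
    (hφuv : S.g.inner x (S.φ x u) v = 0) (i j : Fin 5) :
    S.g.inner x (S.frameVectors x u v i) (S.frameVectors x u v j) = if i = j then 1 else 0 := by
  have hvu : S.g.inner x v u = 0 := by rw [S.g.symm, huv]
  have huξ : S.g.inner x u (S.ξ x) = 0 := by rw [S.g.symm, hξu]
  have hvξ : S.g.inner x v (S.ξ x) = 0 := by rw [S.g.symm, hξv]
  have hvφu : S.g.inner x v (S.φ x u) = 0 := by rw [S.g.symm, hφuv]
  have huφv : S.g.inner x u (S.φ x v) = 0 := by rw [← neg_eq_zero, ← S.inner_φ_left, hφuv]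
  have hφvu : S.g.inner x (S.φ x v) u = 0 := by rw [S.g.symm, huφv]
  have huφu := S.inner_φ_self x u
  have hvφv := S.inner_φ_self x v
  have hφuu : S.g.inner x (S.φ x u) u = 0 := by rw [S.g.symm, huφu]
  have hφvv : S.g.inner x (S.φ x v) v = 0 := by rw [S.g.symm, hvφv]
  have hξφu := S.η_φ x u
  have hξφv := S.η_φ x v
  have hφuξ : S.g.inner x (S.φ x u) (S.ξ x) = 0 := by rw [S.g.symm, hξφu]
  have hφvξ : S.g.inner x (S.φ x v) (S.ξ x) = 0 := by rw [S.g.symm, hξφv]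
  have hφφu : S.g.inner x (S.φ x u) (S.φ x u) = 1 := by rw [S.inner_φ_φ, hξu, hu]; ring
  have hφφv : S.g.inner x (S.φ x v) (S.φ x v) = 1 := by rw [S.inner_φ_φ, hξv, hv]; ring
  have hφuφv : S.g.inner x (S.φ x u) (S.φ x v) = 0 := by rw [S.inner_φ_φ, hξu, huv]; ring
  have hφvφu : S.g.inner x (S.φ x v) (S.φ x u) = 0 := by rw [S.inner_φ_φ, hξu, hvu]; ring
  have hξξ := S.unit_ξ x
  unfold frameVectors
  generalize S.φ x u = u' at *
  generalize S.φ x v = v' at *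
  generalize S.ξ x = w at *
  generalize S.g.inner x = B at *
  fin_cases i <;> fin_cases j <;> simp [*]

theorem Φ_frameVectors {x : M} {u v : TangentSpace I x} (hξu : S.g.inner x (S.ξ x) u = 0)
    (hξv : S.g.inner x (S.ξ x) v = 0)
    (h : ∀ i j : Fin 5, S.g.inner x (S.frameVectors x u v i) (S.frameVectors x u v j)
      = if i = j then 1 else 0) (i j : Fin 5) :
    S.Φ x (S.frameVectors x u v i) (S.frameVectors x u v j) = Phi0 i j := by
  have h0 : S.φ x (S.frameVectors x u v 0) = -S.frameVectors x u v 1 := by simp [frameVectors]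
  have h1 : S.φ x (S.frameVectors x u v 1) = S.frameVectors x u v 0 := by
    simp [frameVectors, S.φ_φ, hξu]
  have h2 : S.φ x (S.frameVectors x u v 2) = -S.frameVectors x u v 3 := by simp [frameVectors]
  have h3 : S.φ x (S.frameVectors x u v 3) = S.frameVectors x u v 2 := by
    simp [frameVectors, S.φ_φ, hξv]
  have h4 : S.φ x (S.frameVectors x u v 4) = 0 := by simp [frameVectors, S.φ_ξ]
  generalize S.frameVectors x u v = e at *
  fin_cases j <;> simp only [Φ, Fin.zero_eta, Fin.mk_one, Fin.reduceFinMk, h0, h1, h2, h3, h4,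
    map_neg, map_zero, h] <;> fin_cases i <;> simp [Phi0]

theorem nonempty_adaptedFrame (hE : Module.finrank ℝ E = 5) (x : M) :
    Nonempty (S.AdaptedFrame x) := by
  obtain ⟨U, X, hU, hxU, -, hX, hX'⟩ := exists_unit_orthogonal S.g (n := 1) (by omega)
    isOpen_univ (Set.mem_univ x) (fun _ ↦ S.ξ) (fun _ ↦ S.contMDiff_ξ.contMDiffOn)
    (fun y _ i j ↦ by rw [S.unit_ξ, if_pos (Subsingleton.elim i j)])
  have hX1 (y) (hy : y ∈ U) := (hX' y hy).1
  have hX2 (y) (hy : y ∈ U) := (hX' y hy).2 0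
  have hφX := S.contMDiffOn_φ hX
  obtain ⟨V, Y, hV, hxV, hVU, hY, hY'⟩ := exists_unit_orthogonal S.g (n := 3) (by omega)
    hU hxU ![S.ξ, X, fun y ↦ S.φ y (X y)]
    (fun i ↦ by
      fin_cases i
      exacts [S.contMDiff_ξ.contMDiffOn, hX, hφX])
    (fun y hy i j ↦ by
      have h1 := S.unit_ξ y
      have h2 := hX1 y hy
      have h3 := hX2 y hy
      have h4 : S.g.inner y (X y) (S.ξ y) = 0 := by rw [S.g.symm, h3]
      have h5 := S.η_φ y (X y)
      have h6 : S.g.inner y (S.φ y (X y)) (S.ξ y) = 0 := by rw [S.g.symm, h5]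
      have h7 := S.inner_φ_self y (X y)
      have h8 : S.g.inner y (S.φ y (X y)) (X y) = 0 := by rw [S.g.symm, h7]
      have h9 : S.g.inner y (S.φ y (X y)) (S.φ y (X y)) = 1 := by
        rw [S.inner_φ_φ, h2, h3]; ring
      fin_cases i <;> fin_cases j
      exacts [h1, h3, h5, h4, h2, h7, h6, h8, h9])
  have hξX (y) (hy : y ∈ V) := hX2 y (hVU hy)
  have hξY (y) (hy : y ∈ V) : S.g.inner y (S.ξ y) (Y y) = 0 := (hY' y hy).2 0
  have hinner (y) (hy : y ∈ V) := S.inner_frameVectors (hX1 y (hVU hy)) (hY' y hy).1 (hξX y hy)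
    (hξY y hy) ((hY' y hy).2 1) ((hY' y hy).2 2)
  have hξ (y) : S.frameVectors y (X y) (Y y) 4 = S.ξ y := rfl
  refine ⟨⟨V, fun i y ↦ S.frameVectors y (X y) (Y y) i, hV, hxV, fun i ↦ ?_, hinner,
    fun y hy i ↦ ?_, fun y hy ↦ S.Φ_frameVectors (hξX y hy) (hξY y hy) (hinner y hy)⟩⟩
  · fin_cases i
    exacts [hX.mono hVU, (hφX.mono hVU).neg_section, hY, (S.contMDiffOn_φ hY).neg_section,
      S.contMDiff_ξ.contMDiffOn]
  · rw [η, ← hξ, hinner y hy]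
    fin_cases i <;> simp [eta0]

end AlmostContactMetricStructure
end FrameExistence

section Classes

theorem eta0_of_ne {i : Fin 5} (hi : i ≠ 4) : eta0 i = 0 := by
  simp [eta0_apply, hi]

theorem perpBlock_zero_four (c d : ℝ) (j : Fin 5) : perpBlock c d 0 4 j = 0 := by
  fin_cases j <;> simp [perpBlock]

variable {E : Type*} [NormedAddCommGroup E] [NormedSpace ℝ E] [FiniteDimensional ℝ E]
  {H : Type*} [TopologicalSpace H] {I : ModelWithCorners ℝ E H}
  {M : Type*} [TopologicalSpace M] [ChartedSpace H M] [IsManifold I ∞ M]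

namespace AlmostContactMetricStructure

namespace AdaptedFrame

variable {S : AlmostContactMetricStructure I M} {x : M} (F : S.AdaptedFrame x)

theorem ext₂ (hE : Module.finrank ℝ E = 5) {f f' : TangentSpace I x → TangentSpace I x → ℝ}
    (h₁ : ∀ v, IsLinearMap ℝ (f · v)) (h₂ : ∀ u, IsLinearMap ℝ (f u ·))
    (h₁' : ∀ v, IsLinearMap ℝ (f' · v)) (h₂' : ∀ u, IsLinearMap ℝ (f' u ·))
    (h : ∀ i j, f (F.e i x) (F.e j x) = f' (F.e i x) (F.e j x)) (u v : TangentSpace I x) :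
    f u v = f' u v := by
  rw [F.apply₂_eq_sum hE h₁ h₂, F.apply₂_eq_sum hE h₁' h₂']
  simp only [h]

theorem ext₃ (hE : Module.finrank ℝ E = 5)
    {f f' : TangentSpace I x → TangentSpace I x → TangentSpace I x → ℝ}
    (h₁ : ∀ v w, IsLinearMap ℝ (f · v w)) (h₂ : ∀ u w, IsLinearMap ℝ (f u · w))
    (h₃ : ∀ u v, IsLinearMap ℝ (f u v ·))
    (h₁' : ∀ v w, IsLinearMap ℝ (f' · v w)) (h₂' : ∀ u w, IsLinearMap ℝ (f' u · w))
    (h₃' : ∀ u v, IsLinearMap ℝ (f' u v ·))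
    (h : ∀ i j k, f (F.e i x) (F.e j x) (F.e k x) = f' (F.e i x) (F.e j x) (F.e k x))
    (u v w : TangentSpace I x) : f u v w = f' u v w := by
  rw [F.apply₃_eq_sum hE h₁ h₂ h₃, F.apply₃_eq_sum hE h₁' h₂' h₃']
  simp only [h]

/-- At a point where the intrinsic torsion is in `W₄ ⊕ W₇`, `γ` is a multiple of `dη` as soon as
this holds for the components. -/
theorem γ_eq_mul_dη (hE : Module.finrank ℝ E = 5) {r s c d t : ℝ}
    (hF : intrinsicTorsion F = etaTensor (perpBlock r s 0) (perpBlock c d 0))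
    (hr : r + c = -t * c) (hs : s + d = -t * d) (u v : TangentSpace I x) :
    S.γ x u v = t * S.dη x u v := by
  refine F.ext₂ hE (S.isLinearMap_γ_left x) (S.isLinearMap_γ_right x)
    (f' := fun u v ↦ t * S.dη x u v)
    (fun v ↦ (t • (S.isLinearMap_dη_left x v).mk').isLinear)
    (fun v ↦ (t • (S.isLinearMap_dη_right x v).mk').isLinear) (fun i j ↦ ?_) u v
  rw [γ_frame F hE, dη_frame, hF, modelγ_etaTensor, modelDη_etaTensor, hr, hs, ← smul_perpBlock,
    Matrix.smul_apply, smul_eq_mul]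
  ring

theorem eq_mul_of_γ_eq_mul_dη (hE : Module.finrank ℝ E = 5) {r s c d t : ℝ}
    (hF : intrinsicTorsion F = etaTensor (perpBlock r s 0) (perpBlock c d 0))
    (h : ∀ u v : TangentSpace I x, S.γ x u v = t * S.dη x u v) :
    r + c = -t * c ∧ s + d = -t * d := by
  have h1 := h (F.e 0 x) (F.e 2 x)
  have h2 := h (F.e 0 x) (F.e 3 x)
  rw [γ_frame F hE, dη_frame, hF, modelγ_etaTensor, modelDη_etaTensor] at h1 h2
  simp [perpBlock] at h1 h2
  constructor <;> linarith

/-- The Nijenhuis tensor at a point where the intrinsic torsion is in `W₄ ⊕ W₇` and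
`γ = t dη`. -/
theorem N_eq_of_torsion (hE : Module.finrank ℝ E = 5) {r s c d t : ℝ}
    (hF : intrinsicTorsion F = etaTensor (perpBlock r s 0) (perpBlock c d 0))
    (hr : r + c = -t * c) (hs : s + d = -t * d) (u v w : TangentSpace I x) :
    S.N x u v w = 2 * (S.η x u * S.dη x v w) + t * (S.η x v * S.dη x u w)
      - t * (S.η x w * S.dη x u v) := by
  have l1 := S.isLinearMap_dη_left x
  have l2 := S.isLinearMap_dη_right x
  refine F.ext₃ hE (S.isLinearMap_N_first x) (S.isLinearMap_N_second x) (S.isLinearMap_N_third x)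
    (f' := fun u v w ↦ 2 * (S.η x u * S.dη x v w) + t * (S.η x v * S.dη x u w)
      - t * (S.η x w * S.dη x u v)) (fun v w ↦ ⟨?_, ?_⟩) (fun v w ↦ ⟨?_, ?_⟩)
    (fun v w ↦ ⟨?_, ?_⟩) (fun i j k ↦ ?_) u v w
  · intro a b
    simp only [map_add, (l1 _).map_add]
    ring
  · intro a b
    simp only [map_smul, (l1 _).map_smul, smul_eq_mul]
    ring
  · intro a b
    simp only [map_add, (l1 _).map_add, (l2 _).map_add]
    ring
  · intro a b
    simp only [map_smul, (l1 _).map_smul, (l2 _).map_smul, smul_eq_mul]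
    ring
  · intro a b
    simp only [map_add, (l2 _).map_add]
    ring
  · intro a b
    simp only [map_smul, (l2 _).map_smul, smul_eq_mul]
    ring
  · simp only [N_frame F hE, dη_frame, hF, modelN_etaTensor, modelDη_etaTensor, hr, hs,
      ← smul_perpBlock, Matrix.smul_apply, smul_eq_mul, F.η_e]
    ring

end AdaptedFrame

variable {S : AlmostContactMetricStructure I M}

theorem dη_swap (x : M) (u v : TangentSpace I x) : S.dη x u v = -S.dη x v u := by
  simp only [dη]
  ring

theorem isOfClass_W4_sup_W7_iff (hE : Module.finrank ℝ E = 5) :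
    S.IsOfClass (W4 ⊔ W7) ↔ S.IsGeneralizedQuasiSasaki ∧
      ∀ (x : M) (u v : TangentSpace I x), S.N x (S.ξ x) u v = 2 * S.dη x u v := by
  constructor
  · intro hW
    refine ⟨⟨fun x u v w hu hv hw ↦ ?_, S.isKilling_iff.2 fun x v w ↦ ?_⟩, fun x u v ↦ ?_⟩ <;>
      obtain ⟨F, hF⟩ := hW x <;> obtain ⟨r, s, c, d, hF⟩ := mem_W4_sup_W7_iff.1 hF
    · constructor
      · refine F.apply₃_eq_zero hE (S.isLinearMap_N_first x) (S.isLinearMap_N_second x)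
          (S.isLinearMap_N_third x) (fun i j k hi hj hk ↦ ?_) hu hv hw
        rw [N_frame F hE, hF, modelN_etaTensor, eta0_of_ne hi, eta0_of_ne hj, eta0_of_ne hk]
        ring
      · refine F.apply₃_eq_zero hE (S.isLinearMap_dΦ_first x) (S.isLinearMap_dΦ_second x)
          (S.isLinearMap_dΦ_third x) (fun i j k hi hj hk ↦ ?_) hu hv hw
        rw [dΦ_frame F hE, hF, modelDΦ_etaTensor, etaTensor, eta0_of_ne hi, eta0_of_ne hj,
          eta0_of_ne hk]
        ring
    · refine F.ext₂ hE (f := fun v w ↦ S.nablaEta x v w + S.nablaEta x w v) (f' := fun _ _ ↦ 0)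
        (fun w ↦ ((S.isLinearMap_nablaEta_left x w).mk' +
          (S.isLinearMap_nablaEta_right x w).mk').isLinear)
        (fun w ↦ ((S.isLinearMap_nablaEta_right x w).mk' +
          (S.isLinearMap_nablaEta_left x w).mk').isLinear)
        (fun _ ↦ (0 : TangentSpace I x →ₗ[ℝ] ℝ).isLinear)
        (fun _ ↦ (0 : TangentSpace I x →ₗ[ℝ] ℝ).isLinear) (fun i j ↦ ?_) v w
      simp only [nablaEta_frame_eq, hF, etaTensor, perpBlock_zero_four, perpBlock_zero_skew c d _ 4,
        perpBlock_zero_skew c d i j]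
      ring
    · refine F.ext₂ hE (S.isLinearMap_N_second x (S.ξ x)) (S.isLinearMap_N_third x (S.ξ x))
        (f' := fun u v ↦ 2 * S.dη x u v)
        (fun v ↦ ((2 : ℝ) • (S.isLinearMap_dη_left x v).mk').isLinear)
        (fun v ↦ ((2 : ℝ) • (S.isLinearMap_dη_right x v).mk').isLinear) (fun i j ↦ ?_) u v
      rw [← F.e_four, N_frame F hE, dη_frame, hF, modelN_etaTensor, modelDη_etaTensor,
        perpBlock_zero_four, perpBlock_zero_four]
      simp [eta0]
      ring
  · rintro ⟨⟨h1, h2⟩, h3⟩ x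
    obtain ⟨F⟩ := S.nonempty_adaptedFrame hE x
    obtain ⟨p, q, a, hT⟩ := intrinsicTorsion_eq_perpBlock F
    have hη {i : Fin 5} (hi : i ≠ 4) : S.η x (F.e i x) = 0 := by rw [F.η_e, eta0_of_ne hi]
    refine ⟨F, mem_W4_sup_W7_of_model hT (fun i j k hi hj hk ↦ ?_) (fun i j k hi hj hk ↦ ?_)
      (fun i j ↦ ?_) (fun i j ↦ ?_)⟩
    · rw [← N_frame F hE]
      exact (h1 x _ _ _ (hη hi) (hη hj) (hη hk)).1
    · rw [← dΦ_frame F hE]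
      exact (h1 x _ _ _ (hη hi) (hη hj) (hη hk)).2
    · rw [← nablaEta_frame_eq, ← nablaEta_frame_eq]
      exact S.isKilling_iff.1 h2 x _ _
    · rw [← N_frame F hE, ← dη_frame, F.e_four]
      exact h3 x _ _

theorem exists_frame_of_isOfClass_W4 (h : S.IsOfClass W4) (x : M) :
    ∃ (F : S.AdaptedFrame x) (r s c d : ℝ),
      intrinsicTorsion F = etaTensor (perpBlock r s 0) (perpBlock c d 0) ∧
      r + c = - -2 * c ∧ s + d = - -2 * d := by
  obtain ⟨F, hF⟩ := h x
  obtain ⟨r, s, hF⟩ := mem_W4_iff.1 hF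
  exact ⟨F, r, s, r, s, hF, by ring, by ring⟩

theorem exists_frame_of_isOfClass_W7 (h : S.IsOfClass W7) (x : M) :
    ∃ (F : S.AdaptedFrame x) (r s c d : ℝ),
      intrinsicTorsion F = etaTensor (perpBlock r s 0) (perpBlock c d 0) ∧
      r + c = -1 * c ∧ s + d = -1 * d := by
  obtain ⟨F, hF⟩ := h x
  obtain ⟨r, s, hF⟩ := mem_W7_iff.1 hF
  exact ⟨F, _, _, _, _, hF, by ring, by ring⟩

theorem γ_eq_of_isOfClass_W4 (hE : Module.finrank ℝ E = 5) (h : S.IsOfClass W4) (x : M)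
    (u v : TangentSpace I x) : S.γ x u v = -2 * S.dη x u v := by
  obtain ⟨F, r, s, c, d, hF, hr, hs⟩ := exists_frame_of_isOfClass_W4 h x
  exact F.γ_eq_mul_dη hE hF hr hs u v

theorem N_eq_of_isOfClass_W4 (hE : Module.finrank ℝ E = 5) (h : S.IsOfClass W4) (x : M)
    (u v w : TangentSpace I x) : S.N x u v w = 2 * S.dηWedgeη x u v w := by
  obtain ⟨F, r, s, c, d, hF, hr, hs⟩ := exists_frame_of_isOfClass_W4 h x
  rw [F.N_eq_of_torsion hE hF hr hs, dηWedgeη, dη_swap x w u]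
  ring

theorem γ_eq_of_isOfClass_W7 (hE : Module.finrank ℝ E = 5) (h : S.IsOfClass W7) (x : M)
    (u v : TangentSpace I x) : S.γ x u v = S.dη x u v := by
  obtain ⟨F, r, s, c, d, hF, hr, hs⟩ := exists_frame_of_isOfClass_W7 h x
  rw [F.γ_eq_mul_dη hE hF hr hs, one_mul]

theorem N_eq_of_isOfClass_W7 (hE : Module.finrank ℝ E = 5) (h : S.IsOfClass W7) (x : M)
    (u v w : TangentSpace I x) : S.N x u v w =
      2 * S.η x u * S.dη x v w + S.η x v * S.dη x u w - S.η x w * S.dη x u v := by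
  obtain ⟨F, r, s, c, d, hF, hr, hs⟩ := exists_frame_of_isOfClass_W7 h x
  rw [F.N_eq_of_torsion hE hF hr hs]
  ring

theorem isTotallySkew_of_isOfClass_W4 (hE : Module.finrank ℝ E = 5) (h : S.IsOfClass W4) :
    S.IsTotallySkew := by
  intro x u v w
  rw [N_eq_of_isOfClass_W4 hE h, N_eq_of_isOfClass_W4 hE h]
  simp only [dηWedgeη, dη]
  ring

theorem isTracelessCyclic_of_isOfClass_W7 (hE : Module.finrank ℝ E = 5) (h : S.IsOfClass W7) :
    S.IsTracelessCyclic := by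
  refine ⟨fun x u v w ↦ ?_, fun x e he u ↦ ?_⟩
  · simp only [N_eq_of_isOfClass_W7 hE h, dη]
    ring
  · have hξ : S.dη x (S.ξ x) u = 0 := by
      rw [← γ_eq_of_isOfClass_W7 hE h, γ, S.φ_ξ]
      simpa using (S.isLinearMap_dΦ_second x (S.ξ x) u).map_zero
    have hsum := map_sum (S.isLinearMap_dη_left x u).mk'
      (fun i ↦ S.g.inner x (e i) (S.ξ x) • e i) Finset.univ
    rw [sum_inner_smul hE S.g he] at hsum
    simp only [IsLinearMap.mk'_apply, (S.isLinearMap_dη_left x u).map_smul, smul_eq_mul, hξ]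
      at hsum
    have e1 (i) : S.N x (e i) (e i) u = 3 * (S.g.inner x (e i) (S.ξ x) * S.dη x (e i) u) := by
      rw [N_eq_of_isOfClass_W7 hE h, S.g.symm x (e i)]
      simp only [η, dη]
      ring
    simp only [e1, ← Finset.mul_sum, ← hsum, mul_zero]

theorem isOfClass_W4_of_γ_eq (hE : Module.finrank ℝ E = 5) (hW : S.IsOfClass (W4 ⊔ W7))
    (h : ∀ (x : M) (u v : TangentSpace I x), S.γ x u v = -2 * S.dη x u v) : S.IsOfClass W4 := by
  intro x
  obtain ⟨F, hF⟩ := hW x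
  obtain ⟨r, s, c, d, hF⟩ := mem_W4_sup_W7_iff.1 hF
  obtain ⟨hr, hs⟩ := F.eq_mul_of_γ_eq_mul_dη hE hF (h x)
  refine ⟨F, mem_W4_iff.2 ⟨c, d, ?_⟩⟩
  rw [hF, show r = c by linarith, show s = d by linarith]

theorem isOfClass_W7_of_γ_eq (hE : Module.finrank ℝ E = 5) (hW : S.IsOfClass (W4 ⊔ W7))
    (h : ∀ (x : M) (u v : TangentSpace I x), S.γ x u v = S.dη x u v) : S.IsOfClass W7 := by
  intro x
  obtain ⟨F, hF⟩ := hW x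
  obtain ⟨r, s, c, d, hF⟩ := mem_W4_sup_W7_iff.1 hF
  obtain ⟨hr, hs⟩ := F.eq_mul_of_γ_eq_mul_dη (t := 1) hE hF (by simpa using h x)
  refine ⟨F, mem_W7_iff.2 ⟨-c, -d, ?_⟩⟩
  rw [hF, show r = 2 * -c by linarith, show s = 2 * -d by linarith, neg_neg, neg_neg]

theorem isOfClass_W4_of_isTotallySkew (hE : Module.finrank ℝ E = 5)
    (hW : S.IsOfClass (W4 ⊔ W7)) (h : S.IsTotallySkew) : S.IsOfClass W4 := by
  intro x
  obtain ⟨F, hF⟩ := hW x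
  obtain ⟨r, s, c, d, hF⟩ := mem_W4_sup_W7_iff.1 hF
  have h1 := h x (F.e 4 x) (F.e 0 x) (F.e 2 x)
  have h2 := h x (F.e 4 x) (F.e 0 x) (F.e 3 x)
  simp only [N_frame F hE, hF, modelN_etaTensor] at h1 h2
  simp [perpBlock, eta0] at h1 h2
  refine ⟨F, mem_W4_iff.2 ⟨c, d, ?_⟩⟩
  rw [hF, show r = c by linarith, show s = d by linarith]

theorem isOfClass_W7_of_cyclic (hE : Module.finrank ℝ E = 5) (hW : S.IsOfClass (W4 ⊔ W7))
    (h : ∀ (x : M) (u v w : TangentSpace I x), S.N x u v w + S.N x v w u + S.N x w u v = 0) :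
    S.IsOfClass W7 := by
  intro x
  obtain ⟨F, hF⟩ := hW x
  obtain ⟨r, s, c, d, hF⟩ := mem_W4_sup_W7_iff.1 hF
  have h1 := h x (F.e 4 x) (F.e 0 x) (F.e 2 x)
  have h2 := h x (F.e 4 x) (F.e 0 x) (F.e 3 x)
  simp only [N_frame F hE, hF, modelN_etaTensor] at h1 h2
  simp [perpBlock, eta0] at h1 h2
  refine ⟨F, mem_W7_iff.2 ⟨-c, -d, ?_⟩⟩
  rw [hF, show r = 2 * -c by linarith, show s = 2 * -d by linarith, neg_neg, neg_neg]

end AlmostContactMetricStructure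
end Classes

end ACM

end

/-- Characterization of the almost contact metric `5`-manifolds of class `W₄ ⊕ W₇`, `W₄` and `W₇`. -/
theorem theorem2 {M : Type*} [TopologicalSpace M] [ChartedSpace (EuclideanSpace ℝ (Fin 5)) M]
    [IsManifold (𝓡 5) ∞ M] (S : ACM.AlmostContactMetricStructure (𝓡 5) M) :
    -- class `W₄ ⊕ W₇`
    (S.IsOfClass (ACM.W4 ⊔ ACM.W7) ↔
      S.IsGeneralizedQuasiSasaki ∧
        ∀ (x : M) (u v : TangentSpace (𝓡 5) x), S.N x (S.ξ x) u v = 2 * S.dη x u v) ∧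
    (S.IsOfClass (ACM.W4 ⊔ ACM.W7) →
      -- class `W₄`
      ((S.IsOfClass ACM.W4 ↔ S.IsTotallySkew) ∧
        (S.IsTotallySkew ↔
          ∀ (x : M) (u v : TangentSpace (𝓡 5) x), S.γ x u v = -2 * S.dη x u v) ∧
        (S.IsOfClass ACM.W4 →
          ∀ (x : M) (u v w : TangentSpace (𝓡 5) x), S.N x u v w = 2 * S.dηWedgeη x u v w)) ∧
      -- class `W₇`
      ((S.IsOfClass ACM.W7 ↔ S.IsTracelessCyclic) ∧
        (S.IsTracelessCyclic ↔
          ∀ (x : M) (u v : TangentSpace (𝓡 5) x), S.γ x u v = S.dη x u v) ∧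
        (S.IsOfClass ACM.W7 →
          ∀ (x : M) (u v w : TangentSpace (𝓡 5) x),
            S.N x u v w =
              2 * S.η x u * S.dη x v w + S.η x v * S.dη x u w - S.η x w * S.dη x u v))) := by
  have hE : Module.finrank ℝ (EuclideanSpace ℝ (Fin 5)) = 5 := finrank_euclideanSpace_fin
  refine ⟨ACM.AlmostContactMetricStructure.isOfClass_W4_sup_W7_iff hE, fun hW ↦ ⟨?_, ?_⟩⟩
  · have h1 := ACM.AlmostContactMetricStructure.isTotallySkew_of_isOfClass_W4 (S := S) hE
    have h2 := ACM.AlmostContactMetricStructure.isOfClass_W4_of_isTotallySkew hE hW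
    have h3 := ACM.AlmostContactMetricStructure.γ_eq_of_isOfClass_W4 (S := S) hE
    have h4 := ACM.AlmostContactMetricStructure.isOfClass_W4_of_γ_eq hE hW
    exact ⟨⟨h1, h2⟩, ⟨fun h ↦ h3 (h2 h), fun h ↦ h1 (h4 h)⟩,
      ACM.AlmostContactMetricStructure.N_eq_of_isOfClass_W4 hE⟩
  · have h1 := ACM.AlmostContactMetricStructure.isTracelessCyclic_of_isOfClass_W7 (S := S) hE
    have h2 (h : S.IsTracelessCyclic) :=
      ACM.AlmostContactMetricStructure.isOfClass_W7_of_cyclic hE hW h.1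
    have h3 := ACM.AlmostContactMetricStructure.γ_eq_of_isOfClass_W7 (S := S) hE
    have h4 := ACM.AlmostContactMetricStructure.isOfClass_W7_of_γ_eq hE hW
    exact ⟨⟨h1, h2⟩, ⟨fun h ↦ h3 (h2 h), fun h ↦ h1 (h4 h)⟩,
      ACM.AlmostContactMetricStructure.N_eq_of_isOfClass_W7 hE⟩
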